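/- **Model.** Let $G$ be a connected undirected graph on the vertex set $\{1,\dots,m\}$, with a player at every vertex. Player $i$ holds $X_i\in\{0,1,\dots,M\}^n$; write $\mathcal X=\sum_{i=1}^m X_i$ for the aggregate vector. All players know $G,n,M,\epsilon$, share an infinite public string of independent fair random bits, and have unbounded computational power. A protocol runs in synchronous rounds; in every round each player may send bits to its neighbours in $G$, computed from its own input, the public string and the messages it received in earlier rounds. The number of bits sent over each edge in each round is fixed in advance. A message is seen only by its recipient. At the end a player fixed in advance outputs a real number. The *max-communication* is the maximum, over the edges of $G$, of the total number of bits sent across the edge in both directions during the execution. The Shannon entropy of $\mathcal X\neq 0$ is $$H(\mathcal X)=\sum_{j=1}^n \frac{|\mathcal X_j|}{\|\mathcal X\|_1}\log\frac{\|\mathcal X\|_1}{|\mathcal X_j|},$$ where $\log$ is the natural logarithm and terms with $\mathcal X_j=0$ are $0$. A protocol *estimates the entropy to within $\epsilon$* if for every choice of inputs with $\mathcal X\ne0$ its output $\tilde H$ satisfies $|\tilde H-H(\mathcal X)|\le\epsilon$ with probability at least $3/4$ over the public string. **Theorem 5.3.** (a) There is an absolute constant $C$ such that for all $n,m,M\in\mathbb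 N$ with $nmM\ge 3$, all $0<\epsilon<1$ and every connected graph $G$ on $m$ vertices there is a protocol on $G$ that estimates the entropy to within $\epsilon$ and has max-communication at most $$\frac{C}{\epsilon^{2}}\Bigl(\log\log (nmM)+\log\frac1\epsilon\Bigr)\ \text{ bits.}$$ (b) In particular, if the number of players and the size of the entries are polynomial in $n$, the bound is $O(\epsilon^{-2}(\log\log n+\log\frac1\epsilon))$: for all real $K,c$ there is a constant $C$ such that for all $n\ge 3$, all $m,M\in\mathbb N$ with $m,M\le K n^c$, all $0<\epsilon<1$ and every connected graph $G$ on $m$ vertices there is a protocol on $G$ that estimates the entropy to within $\epsilon$ and has max-communication at most $$\frac{C}{\epsilon^{2}}\Bigl(\log\log n+\log\frac1\epsilon\Bigr)\ \text{ bits.}$$ -/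

import Mathlib

open MeasureTheory

noncomputable section

namespace MessagePassing

/-- The public random string: an infinite sequence of bits. -/
abbrev Coins : Type := ℕ → Bool

/-- The law of an infinite sequence of independent fair bits. -/
def coinLaw : Measure Coins :=
  Measure.infinitePi (fun _ : ℕ => (PMF.uniformOfFintype Bool).toMeasure)

/-- A public-coin protocol in the message passing model on the communication graph `G`, where every
vertex is a player whose private input has type `I`.

The execution proceeds in synchronous rounds `0, …, rounds - 1`. In round `t` player `u` sends to
player `v` the bit string `msg t u v x ω h`, where `x` is the input of `u`, `ω` is the public random
string, and `h` is what `u` has received so far: a list with one entry per earlier round, the most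
recent one first, each entry telling which string arrived from which player. A message that `u`
sends to `v` enters the view of `v` only.

The number of bits sent in each round over each edge is fixed in advance (`length_msg`), so that no
information is conveyed by the length of a message or by the time at which it is sent; nothing is
ever sent between players that are not adjacent (`len_eq_zero`). After the last round, the
distinguished player `center` outputs a real number, computed from its own input, the public random
string and the messages it received. The players have unbounded computational power. -/
structure Protocol {V : Type} (G : SimpleGraph V) (I : Type) where
  /-- the number of rounds -/
  rounds : ℕ
  /-- `len t u v` is the number of bits that `u` sends to `v` in round `t` -/
  len : ℕ → V → V → ℕ
  len_eq_zero : ∀ t u v, ¬ G.Adj u v → len t u v = 0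
  /-- the message from `u` to `v` in round `t` -/
  msg : ℕ → V → V → I → Coins → List (V → List Bool) → List Bool
  length_msg : ∀ t u v x ω h, (msg t u v x ω h).length = len t u v
  measurableSet_msg : ∀ t u v x h b, MeasurableSet {ω | msg t u v x ω h = b}
  /-- the distinguished player that holds the output -/
  center : V
  /-- the output of the distinguished player -/
  out : I → Coins → List (V → List Bool) → ℝ
  measurable_out : ∀ x h, Measurable (fun ω => out x ω h)

namespace Protocol

variable {V : Type} {G : SimpleGraph V} {I : Type}

/-- `P.view X ω t u` lists the messages that player `u` received in the rounds `0, …, t - 1` (most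
recent round first) when `P` is run on the inputs `X` with the public random string `ω`. -/
def view (P : Protocol G I) (X : V → I) (ω : Coins) : ℕ → V → List (V → List Bool)
  | 0, _ => []
  | t + 1, u => (fun w => P.msg t w u (X w) ω (P.view X ω t w)) :: P.view X ω t u

/-- The output of the protocol on the inputs `X` with the public random string `ω`. -/
def output (P : Protocol G I) (X : V → I) (ω : Coins) : ℝ :=
  P.out (X P.center) ω (P.view X ω P.rounds P.center)

/-- The number of bits sent between `u` and `v`, in both directions, over the whole execution. -/
def edgeBits (P : Protocol G I) (u v : V) : ℕ :=
  ∑ t ∈ Finset.range P.rounds, (P.len t u v + P.len t v u)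

/-- The max-communication: the maximum, over all edges, of the number of bits sent across the edge
during the execution. (Pairs that are not edges contribute `0`.) -/
def maxCommunication [Fintype V] (P : Protocol G I) : ℕ :=
  Finset.univ.sup (fun e : V × V => P.edgeBits e.1 e.2)

end Protocol

/-- The empirical Shannon entropy `∑ⱼ (|xⱼ| / ‖x‖₁) log (‖x‖₁ / |xⱼ|)` of a nonzero vector, with the
natural logarithm; coordinates with `xⱼ = 0` contribute `0`. -/
def shannonEntropy {n : ℕ} (x : Fin n → ℝ) : ℝ :=
  ∑ j, (|x j| / ∑ i, |x i|) * Real.log ((∑ i, |x i|) / |x j|)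

/-- The aggregate vector `∑ᵢ Xᵢ` of the inputs `Xᵢ ∈ {0, …, M}ⁿ` of `m` players. -/
def aggregate {m n M : ℕ} (X : Fin m → Fin n → Fin (M + 1)) (j : Fin n) : ℝ :=
  ∑ i, ((X i j : ℕ) : ℝ)

/-- `P` estimates the Shannon entropy of the aggregate vector up to an additive error of `ε`: on
every tuple of inputs in `{0, …, M}ⁿ` whose aggregate is not the zero vector, the output is within
`ε` of the entropy with probability at least `3/4` over the public random string. -/
def EstimatesEntropy {m n M : ℕ} {G : SimpleGraph (Fin m)}
    (P : Protocol G (Fin n → Fin (M + 1))) (ε : ℝ) : Prop :=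
  ∀ X : Fin m → Fin n → Fin (M + 1), aggregate X ≠ 0 →
    3 / 4 ≤ coinLaw.real {ω | |P.output X ω - shannonEntropy (aggregate X)| ≤ ε}

end MessagePassing

end

/-! Suppose that a nonnegative random variable `Z` had Laplace transform `exp (t log t - t log α)`.
For independent copies `Zⱼ` and a probability vector `p` the transforms multiply, so `exp (-∑ⱼ pⱼ
Zⱼ)` would have mean `exp (-H(p)) / α`. Replacing `p` by `2p` shows that the second moment is only
four times the squared mean, so an average of `O(1/ε²)` independent copies determines `H` up to `ε`.
`exists_entropySketch` constructs such a `Z` up to a small error for `t` between `1/N` and `2`,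
where `N = nmM`, and `measureReal_average_le` controls the average.

The exponent `∑ⱼ pⱼ Zⱼ` is a quotient of two linear functions of the aggregate: a sketch `∑ⱼ xⱼ Zⱼ`,
with `Zⱼ` discretized in units of `τ`, and the `ℓ¹`-norm. Linear registers can be added up towards
the root of a spanning tree. To save bits, every vertex rounds its partial sum, randomly and without
bias, to `0` or a power of `g = 1 + γ` and sends only the exponent. The errors do not accumulate: by
`RootedTree.variance_val_le` the relative variance is at most `g - 1` for every tree. A relative
precision `η` polynomial in `ε` and `1 / log N` is enough (`abs_entropyEstimate_sub_le`). The
exponents are then polynomial in `1/ε` and `log N`, and are written with `O(log log N + log (1/ε))`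
bits.

Sketches and rounding thresholds are drawn from continuous laws, but there are only finitely many
inputs. By the strong law of large numbers a finite sample serves all of them
(`exists_finite_sample`), and the public bits select one of its members. `exists_entropyProtocol`
combines these ingredients and `exists_entropyProtocol_bits` fixes the parameters. -/

open ProbabilityTheory Filter Topology

noncomputable section

namespace MessagePassing

/-! ### Finite samples and the public bits -/

/-- Finitely many events, each of probability less than `p`, are all hit by at most a fraction `p`
of a suitable finite sample, whose size can be taken to be a power of two. -/
theorem exists_finite_sample {Ω : Type*} [MeasurableSpace Ω] (μ : Measure Ω)
    [IsProbabilityMeasure μ] {ι : Type*} [Finite ι] (A : ι → Set Ω) (p : ℝ)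
    (hA : ∀ x, μ.real (A x) < p) :
    ∃ (L : ℕ) (s : Fin (2 ^ L) → Ω), ∀ x, ((Nat.card {i // s i ∈ A x} : ℕ) : ℝ) ≤ p * 2 ^ L := by
  classical
  -- Measurable hulls have the same measure, so the events themselves need not be measurable.
  let B : ι → Set Ω := fun x => toMeasurable μ (A x)
  have hBm : ∀ x, MeasurableSet (B x) := fun x => measurableSet_toMeasurable _ _
  have hB : ∀ x, μ.real (B x) < p := fun x => by
    have : μ.real (B x) = μ.real (A x) := by simp [B, Measure.real, measure_toMeasurable]
    rw [this]; exact hA x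
  let P : Measure (ℕ → Ω) := Measure.infinitePi (fun _ : ℕ => μ)
  have key : ∀ x, ∀ᵐ ω ∂P, Tendsto (fun n : ℕ =>
      (∑ i ∈ Finset.range n, (B x).indicator (fun _ => (1 : ℝ)) (ω i)) / n) atTop
      (𝓝 (μ.real (B x))) := by
    intro x
    have hm : Measurable ((B x).indicator (fun _ => (1 : ℝ))) :=
      measurable_const.indicator (hBm x)
    have hind : iIndepFun (fun (i : ℕ) (ω : ℕ → Ω) => (B x).indicator (fun _ => (1 : ℝ)) (ω i)) P :=
      iIndepFun_infinitePi (P := fun _ : ℕ => μ)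
        (X := fun (_ : ℕ) => (B x).indicator (fun _ => (1 : ℝ))) (fun _ => hm)
    have hmap : ∀ i : ℕ, P.map (fun ω => ω i) = μ :=
      fun i => Measure.infinitePi_map_eval (μ := fun _ : ℕ => μ) i
    have hmp : ∀ i : ℕ, MeasurePreserving (fun ω : ℕ → Ω => ω i) P μ :=
      fun i => ⟨measurable_pi_apply i, hmap i⟩
    have hint : Integrable ((B x).indicator (fun _ => (1 : ℝ))) μ :=
      (integrable_const (1 : ℝ)).indicator (hBm x)
    have h := strong_law_ae_real (μ := P)
      (fun (i : ℕ) (ω : ℕ → Ω) => (B x).indicator (fun _ => (1 : ℝ)) (ω i))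
      ((hmp 0).integrable_comp_of_integrable hint) (fun i j hij => hind.indepFun hij)
      (fun i => by
        refine ⟨(hm.comp (measurable_pi_apply i)).aemeasurable,
          (hm.comp (measurable_pi_apply 0)).aemeasurable, ?_⟩
        change Measure.map ((B x).indicator (fun _ => (1 : ℝ)) ∘ fun ω : ℕ → Ω => ω i) P =
          Measure.map ((B x).indicator (fun _ => (1 : ℝ)) ∘ fun ω : ℕ → Ω => ω 0) P
        rw [← Measure.map_map hm (measurable_pi_apply i),
          ← Measure.map_map hm (measurable_pi_apply 0), hmap, hmap])
    have hE : ∫ ω, (B x).indicator (fun _ => (1 : ℝ)) (ω 0) ∂P = μ.real (B x) := by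
      rw [← integral_indicator_one (hBm x), ← hmap 0, integral_map
        (measurable_pi_apply 0).aemeasurable (by rw [hmap]; exact (measurable_const.indicator (hBm x)).aestronglyMeasurable)]
      rfl
    rw [hE] at h
    exact h
  have key2 := ae_all_iff.2 key
  obtain ⟨ω, hω⟩ := key2.exists
  have h2 : Tendsto (fun L : ℕ => 2 ^ L) atTop (atTop : Filter ℕ) :=
    tendsto_pow_atTop_atTop_of_one_lt (by norm_num)
  -- Finiteness of `ι` gives one sample size for all events; along the powers of two a uniform index
  -- is exactly a block of fair bits.
  have h3 : ∀ᶠ L : ℕ in atTop, ∀ x, (∑ i ∈ Finset.range (2 ^ L),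
      (B x).indicator (fun _ => (1 : ℝ)) (ω i)) / ((2 ^ L : ℕ) : ℝ) < p :=
    eventually_all.2 fun x => h2.eventually ((hω x).eventually (gt_mem_nhds (hB x)))
  obtain ⟨L, hL⟩ := h3.exists
  refine ⟨L, fun i => ω i, fun x => ?_⟩
  have h4 := hL x
  have hpos : (0 : ℝ) < ((2 ^ L : ℕ) : ℝ) := by positivity
  rw [div_lt_iff₀ hpos] at h4
  push_cast at h4
  refine le_trans ?_ h4.le
  rw [Nat.card_eq_fintype_card, Fintype.card_subtype, Finset.sum_range, ← Finset.sum_boole]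
  refine Finset.sum_le_sum fun i _ => ?_
  by_cases hi : ω i ∈ A x
  · have : ω i ∈ B x := subset_toMeasurable _ _ hi
    simp [hi, this]
  · rw [if_neg hi]
    exact Set.indicator_nonneg (fun _ _ => zero_le_one) _

/-- The first `L` public bits. -/
def firstCoins (L : ℕ) (ω : Coins) : Fin L → Bool := fun i => ω i

theorem measurable_firstCoins (L : ℕ) : Measurable (firstCoins L) :=
  measurable_pi_lambda _ fun _ => measurable_pi_apply _

theorem coinLaw_firstCoins_eq (L : ℕ) (σ : Fin L → Bool) :
    coinLaw.real {ω | firstCoins L ω = σ} = (1 / 2) ^ L := by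
  have h : {ω : Coins | firstCoins L ω = σ} =
      Set.pi (Finset.range L) (fun i => if h : i < L then {σ ⟨i, h⟩} else Set.univ) := by
    ext ω
    simp only [Set.mem_ofPred_eq, Set.mem_pi, Finset.coe_range, Set.mem_Iio, funext_iff, firstCoins]
    constructor
    · intro h i hi
      simp [hi, h ⟨i, hi⟩]
    · intro h i
      simpa [i.2] using h i i.2
  rw [h, coinLaw, Measure.real, Measure.infinitePi_pi, ENNReal.toReal_prod]
  · rw [Finset.prod_congr rfl (g := fun _ => (1 / 2 : ℝ))]
    · simp
    · intro i hi
      rw [dif_pos (Finset.mem_range.1 hi), PMF.toMeasure_apply_singleton _ _ (by simp)]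
      simp
  · intro i hi
    exact MeasurableSet.of_discrete

theorem coinLaw_firstCoins_mem (L : ℕ) (S : Finset (Fin L → Bool)) :
    coinLaw.real {ω | firstCoins L ω ∈ S} = (S.card : ℝ) / 2 ^ L := by
  have : IsProbabilityMeasure coinLaw := by unfold coinLaw; infer_instance
  have h : {ω : Coins | firstCoins L ω ∈ S} = ⋃ σ ∈ S, {ω | firstCoins L ω = σ} := by
    ext ω; simp
  rw [h, measureReal_biUnion_finset]
  · simp_rw [coinLaw_firstCoins_eq]
    simp [div_eq_mul_inv]
  · intro a _ b _ hab
    refine Set.disjoint_left.2 fun ω h1 h2 => hab ?_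
    rw [← h1, ← h2]
  · intro b _
    exact measurable_firstCoins L (measurableSet_singleton b)

/-! ### Convergecast on a spanning tree -/

/-- A connected graph has a spanning tree, given by parents and depths, with any prescribed root. -/
theorem exists_parent {V : Type} {G : SimpleGraph V} (hG : G.Connected) (root : V) :
    ∃ (par : V → V) (d : V → ℕ), d root = 0 ∧
      ∀ u, u ≠ root → G.Adj u (par u) ∧ d u = d (par u) + 1 := by
  have h : ∀ u, ∃ v, u ≠ root → G.Adj u v ∧ G.dist u root = G.dist v root + 1 := by
    intro u
    by_cases hu : u = root
    · exact ⟨u, fun h => absurd hu h⟩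
    obtain ⟨w, hw⟩ := hG.exists_walk_length_eq_dist u root
    cases w with
    | nil => exact absurd rfl hu
    | @cons _ v _ hadj p =>
      refine ⟨v, fun _ => ⟨hadj, ?_⟩⟩
      have h1 : G.dist v root ≤ p.length := SimpleGraph.dist_le p
      have h2 : G.dist u root ≤ G.dist u v + G.dist v root := hG.dist_triangle
      have h3 : G.dist u v = 1 := SimpleGraph.dist_eq_one_iff_adj.2 hadj
      rw [SimpleGraph.Walk.length_cons] at hw
      omega
  choose par hpar using h
  exact ⟨par, fun u => G.dist u root, by simp, hpar⟩

/-- Convergecast on a rooted spanning tree: every vertex combines its input with the values that it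
got from its children, and passes the result, encoded by `B` bits, to its parent. -/
theorem exists_treeProtocol {V : Type} [Fintype V] {G : SimpleGraph V} {root : V} {par : V → V}
    {d : V → ℕ} (hroot : d root = 0)
    (hpar : ∀ u, u ≠ root → G.Adj u (par u) ∧ d u = d (par u) + 1) {I A : Type} {B L : ℕ}
    (enc : A → List Bool) (dec : List Bool → A) (hdec : ∀ a, dec (enc a) = a)
    (hlen : ∀ a, (enc a).length = B)
    (step : (Fin L → Bool) → V → I → (V → A) → A)
    (hstep : ∀ σ u x f f', (∀ w, w ≠ root → par w = u → f w = f' w) →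
      step σ u x f = step σ u x f')
    (fin : (Fin L → Bool) → A → ℝ) :
    ∃ P : Protocol G I, P.maxCommunication ≤ 2 * B ∧
      ∀ (X : V → I) (ω : Coins) (c : V → A),
        (∀ u, c u = step (firstCoins L ω) u (X u) c) →
          P.output X ω = fin (firstCoins L ω) (c root) := by
  classical
  set D : ℕ := Finset.univ.sup d with hD
  have hdD : ∀ u, d u ≤ D := fun u => Finset.le_sup (f := d) (Finset.mem_univ u)
  -- Only the latest round matters: a vertex at depth `d` sends in round `D - d`, and its children
  -- sent in the round just before. The default is read only when nothing has been received, and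
  -- then `hstep` makes it irrelevant.
  let rec' : List (V → List Bool) → V → A := fun h w => dec (h.headD (fun _ => []) w)
  have hmeas : ∀ {β : Type} (f : (Fin L → Bool) → β) (S : Set β),
      MeasurableSet {ω | f (firstCoins L ω) ∈ S} := fun f S =>
    measurable_firstCoins L (MeasurableSet.of_discrete (s := f ⁻¹' S))
  let P : Protocol G I :=
    { rounds := D
      len := fun t u v => if u ≠ root ∧ par u = v ∧ t + d u = D then B else 0
      len_eq_zero := by
        intro t u v huv
        rw [if_neg]
        rintro ⟨h1, rfl, _⟩
        exact huv (hpar u h1).1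
      msg := fun t u v x ω h => if u ≠ root ∧ par u = v ∧ t + d u = D then
        enc (step (firstCoins L ω) u x (rec' h)) else []
      length_msg := by
        intro t u v x ω h
        split_ifs <;> simp [hlen]
      measurableSet_msg := by
        intro t u v x h b
        split_ifs
        · exact hmeas (fun σ => enc (step σ u x (rec' h))) {b}
        · exact MeasurableSet.const _
      center := root
      out := fun x ω h => fin (firstCoins L ω) (step (firstCoins L ω) root x (rec' h))
      measurable_out := by
        intro x h S _
        exact hmeas (fun σ => fin σ (step σ root x (rec' h))) S }
  refine ⟨P, ?_, ?_⟩
  · refine Finset.sup_le fun e _ => ?_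
    have hle : ∀ u v, ∑ t ∈ Finset.range D, P.len t u v ≤ B := by
      intro u v
      calc ∑ t ∈ Finset.range D, P.len t u v
          ≤ ∑ t ∈ Finset.range D, if t = D - d u then B else 0 := by
            refine Finset.sum_le_sum fun t _ => ?_
            change (if u ≠ root ∧ par u = v ∧ t + d u = D then B else 0) ≤ _
            split_ifs <;> omega
        _ ≤ B := by
            rw [Finset.sum_ite_eq']
            split_ifs <;> simp
    change ∑ t ∈ Finset.range D, (P.len t e.1 e.2 + P.len t e.2 e.1) ≤ 2 * B
    rw [Finset.sum_add_distrib]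
    have h1 := hle e.1 e.2
    have h2 := hle e.2 e.1
    omega
  · intro X ω c hc
    have key : ∀ t u, d u + t = D →
        step (firstCoins L ω) u (X u) (rec' (P.view X ω t u)) = c u := by
      intro t
      induction t with
      | zero =>
        intro u hu
        rw [hc u]
        refine hstep _ _ _ _ _ fun w hw hwu => ?_
        have h1 := (hpar w hw).2
        have h2 := hdD w
        rw [hwu] at h1
        omega
      | succ t ih =>
        intro u hu
        conv_rhs => rw [hc u]
        refine hstep _ _ _ _ _ fun w hw hwu => ?_
        have h1 := (hpar w hw).2
        rw [hwu] at h1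
        change dec (P.msg t w u (X w) ω (P.view X ω t w)) = c w
        have h3 : P.msg t w u (X w) ω (P.view X ω t w) =
            enc (step (firstCoins L ω) w (X w) (rec' (P.view X ω t w))) :=
          if_pos ⟨hw, hwu, by omega⟩
        rw [h3, hdec]
        exact ih w (by omega)
    change fin _ (step (firstCoins L ω) root (X root) (rec' (P.view X ω D root))) = _
    rw [key D root (by omega)]

/-! ### Unbiased rounding of a single number -/

/-- The value that a code stands for: `0` or a power of `g`. -/
def gridVal (g : ℝ) : ℕ → ℝ
  | 0 => 0
  | e + 1 => g ^ e

/-- Randomized rounding of `s` (with `s = 0` or `1 ≤ s`) to `0` or a power of `g`, by means of a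
uniform threshold `θ`. The result is the code of the rounded value. -/
def roundCode (g s θ : ℝ) : ℕ :=
  if s < 1 then 0
  else if θ * (g ^ (⌊Real.log s / Real.log g⌋₊ + 1) - g ^ ⌊Real.log s / Real.log g⌋₊) <
      s - g ^ ⌊Real.log s / Real.log g⌋₊ then ⌊Real.log s / Real.log g⌋₊ + 2
  else ⌊Real.log s / Real.log g⌋₊ + 1

/-- The uniform distribution on the unit interval. -/
def unif : Measure ℝ := volume.restrict (Set.Ioc 0 1)

instance : IsProbabilityMeasure unif := ⟨by simp [unif]⟩

theorem gridVal_nonneg {g : ℝ} (hg : 1 < g) (c : ℕ) : 0 ≤ gridVal g c := by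
  cases c with
  | zero => exact le_rfl
  | succ e => exact pow_nonneg (by linarith) e

theorem gridVal_eq_zero_or {g : ℝ} (hg : 1 < g) (c : ℕ) :
    gridVal g c = 0 ∨ 1 ≤ gridVal g c := by
  cases c with
  | zero => exact Or.inl rfl
  | succ e => exact Or.inr (one_le_pow₀ hg.le)

theorem measurable_roundCode (g : ℝ) : Measurable (fun p : ℝ × ℝ => roundCode g p.1 p.2) := by
  have he : Measurable (fun p : ℝ × ℝ => ⌊Real.log p.1 / Real.log g⌋₊) :=
    Nat.measurable_floor.comp ((Real.measurable_log.comp measurable_fst).div_const _)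
  have hpow : Measurable (fun k : ℕ => g ^ k) := measurable_from_top
  have hp0 := hpow.comp he
  have hp1 := hpow.comp (he.add_const 1)
  refine Measurable.ite (measurableSet_lt measurable_fst measurable_const) measurable_const ?_
  refine Measurable.ite (measurableSet_lt (measurable_snd.mul (hp1.sub hp0))
    (measurable_fst.sub hp0)) (he.add_const 2) (he.add_const 1)

theorem pow_floor_log_le {g s : ℝ} (hg : 1 < g) (hs : 1 ≤ s) :
    g ^ ⌊Real.log s / Real.log g⌋₊ ≤ s ∧ s < g ^ (⌊Real.log s / Real.log g⌋₊ + 1) := by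
  have hlg : 0 < Real.log g := Real.log_pos hg
  have hg0 : 0 < g := by linarith
  have hs0 : 0 < s := by linarith
  have h0 : 0 ≤ Real.log s / Real.log g := div_nonneg (Real.log_nonneg hs) hlg.le
  constructor
  · have h1 := Nat.floor_le h0
    rw [le_div_iff₀ hlg, ← Real.log_pow] at h1
    exact (Real.log_le_log_iff (by positivity) hs0).1 h1
  · have h1 := Nat.lt_floor_add_one (Real.log s / Real.log g)
    rw [div_lt_iff₀ hlg] at h1
    rw [← Real.log_lt_log_iff hs0 (by positivity), Real.log_pow]
    exact_mod_cast h1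

theorem gridVal_roundCode_le {g s : ℝ} (hg : 1 < g) (hs : 0 ≤ s) (θ : ℝ) :
    gridVal g (roundCode g s θ) ≤ g * s := by
  unfold roundCode
  split_ifs with h1 h2
  · exact mul_nonneg (by linarith) hs
  · have := (pow_floor_log_le hg (not_lt.1 h1)).1
    change g ^ (_ + 1) ≤ _
    rw [pow_succ']
    exact mul_le_mul_of_nonneg_left this (by linarith)
  · have := (pow_floor_log_le hg (not_lt.1 h1)).1
    change g ^ _ ≤ _
    nlinarith

theorem integral_unif_ite {w c : ℝ} (hw : 0 < w) (hc : 0 ≤ c) (hcw : c ≤ w) (y z : ℝ) :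
    ∫ θ, (if θ * w < c then y else z) ∂unif = z + (y - z) * (c / w) := by
  have h : (fun θ : ℝ => if θ * w < c then y else z) =
      fun θ => z + (y - z) * (Set.Iio (c / w)).indicator (fun _ => (1 : ℝ)) θ := by
    funext θ
    by_cases hθ : θ * w < c
    · have : θ < c / w := (lt_div_iff₀ hw).2 hθ
      simp [hθ, this]
    · have : ¬ θ < c / w := fun h => hθ ((lt_div_iff₀ hw).1 h)
      simp [hθ, this]
  have hq1 : c / w ≤ 1 := (div_le_one hw).2 hcw
  have hq0 : 0 ≤ c / w := div_nonneg hc hw.le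
  have hm : unif.real (Set.Iio (c / w)) = c / w := by
    have : Set.Iio (c / w) ∩ Set.Ioc 0 1 = Set.Ioo 0 (c / w) := by
      ext x
      simp only [Set.mem_inter_iff, Set.mem_Iio, Set.mem_Ioc, Set.mem_Ioo]
      constructor
      · rintro ⟨h1, h2, h3⟩; exact ⟨h2, h1⟩
      · rintro ⟨h1, h2⟩; exact ⟨h2, h1, by linarith⟩
    rw [unif, Measure.real, Measure.restrict_apply measurableSet_Iio, this, Real.volume_Ioo]
    simp [hq0]
  rw [h, integral_add (integrable_const _) ((((integrable_const (1 : ℝ)).indicator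
    measurableSet_Iio)).const_mul _), integral_const_mul]
  have h1 := integral_indicator_one (μ := unif) (measurableSet_Iio (a := c / w))
  change ∫ θ, (Set.Iio (c / w)).indicator (fun _ => (1 : ℝ)) θ ∂unif = _ at h1
  rw [h1, hm]
  simp

/-- The rounded value has a two-point law on the neighbouring powers of `g`. An arbitrary `f` allows
the first and the second moment to be read off together. -/
theorem integral_roundCode {g s : ℝ} (hg : 1 < g) (hs : 1 ≤ s) (f : ℕ → ℝ) :
    ∃ e : ℕ, g ^ e ≤ s ∧ s < g ^ (e + 1) ∧ ∫ θ, f (roundCode g s θ) ∂unif =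
      f (e + 1) + (f (e + 2) - f (e + 1)) * ((s - g ^ e) / (g ^ (e + 1) - g ^ e)) := by
  obtain ⟨h1, h2⟩ := pow_floor_log_le hg hs
  refine ⟨_, h1, h2, ?_⟩
  rw [← integral_unif_ite (by linarith) (by linarith) (by linarith)]
  congr 1
  funext θ
  rw [roundCode, if_neg (not_lt.2 hs)]
  split_ifs <;> rfl

theorem integral_gridVal_roundCode {g s : ℝ} (hg : 1 < g) (hs : s = 0 ∨ 1 ≤ s) :
    ∫ θ, gridVal g (roundCode g s θ) ∂unif = s := by
  rcases hs with rfl | hs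
  · simp [roundCode, gridVal]
  obtain ⟨e, h1, h2, h3⟩ := integral_roundCode hg hs (gridVal g)
  rw [h3]
  change g ^ e + (g ^ (e + 1) - g ^ e) * _ = s
  rw [mul_div_cancel₀ _ (by linarith : g ^ (e + 1) - g ^ e ≠ 0)]
  ring

/-- The variance of the rounding is `(s - g ^ e) * (g ^ (e + 1) - s)`. The first factor is at most
the distance from `s` to any grid value below it, the second at most `(g - 1) * s`. The factor `s -
gridVal g c` makes the bound vanish when `s` is that grid value, which is what prevents accumulation
along a path. -/
theorem integral_gridVal_roundCode_sq_le {g s : ℝ} (hg : 1 < g) (hs : s = 0 ∨ 1 ≤ s) {c : ℕ}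
    (hc : gridVal g c ≤ s) :
    ∫ θ, gridVal g (roundCode g s θ) ^ 2 ∂unif ≤ s ^ 2 + (g - 1) * (s * (s - gridVal g c)) := by
  rcases hs with rfl | hs
  · simp [roundCode, gridVal]
  obtain ⟨e, h1, h2, h3⟩ := integral_roundCode hg hs (fun c => gridVal g c ^ 2)
  rw [h3]
  change (g ^ e) ^ 2 + ((g ^ (e + 1)) ^ 2 - (g ^ e) ^ 2) * _ ≤ _
  have hne : g ^ (e + 1) - g ^ e ≠ 0 := by linarith
  have h4 : ((g ^ (e + 1)) ^ 2 - (g ^ e) ^ 2) * ((s - g ^ e) / (g ^ (e + 1) - g ^ e)) =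
      (g ^ (e + 1) + g ^ e) * (s - g ^ e) := by
    field_simp
    ring
  -- No grid value lies strictly between `g ^ e` and `s`.
  have hv : gridVal g c ≤ g ^ e := by
    cases c with
    | zero => exact pow_nonneg (by linarith) e
    | succ k =>
      have : g ^ k < g ^ (e + 1) := lt_of_le_of_lt hc h2
      have := (pow_lt_pow_iff_right₀ hg).1 this
      exact pow_le_pow_right₀ hg.le (by omega)
  rw [h4]
  have h5 : (s - g ^ e) * (g ^ (e + 1) - s) ≤ (s - gridVal g c) * ((g - 1) * s) := by
    apply mul_le_mul
    · linarith
    · have : g ^ (e + 1) = g * g ^ e := pow_succ' g e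
      nlinarith
    · linarith
    · linarith
  nlinarith

/-! ### Rounded summation on a rooted tree -/

/-- Resampling one coordinate preserves a product measure. -/
theorem measurePreserving_update {V : Type*} [Fintype V] [DecidableEq V] {X : V → Type*}
    [∀ v, MeasurableSpace (X v)] (μ : ∀ v, Measure (X v)) [∀ v, IsProbabilityMeasure (μ v)]
    (v : V) :
    MeasurePreserving (fun p : (∀ v, X v) × X v => Function.update p.1 v p.2)
      ((Measure.pi μ).prod (μ v)) (Measure.pi μ) := by
  have hm : Measurable (fun p : (∀ v, X v) × X v => Function.update p.1 v p.2) := by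
    refine measurable_pi_lambda _ fun w => ?_
    by_cases h : w = v
    · subst h
      simpa using measurable_snd
    · simp only [Function.update_of_ne h]
      exact (measurable_pi_apply w).comp measurable_fst
  refine ⟨hm, (Measure.pi_eq fun s hs => ?_).symm⟩
  rw [Measure.map_apply hm (MeasurableSet.univ_pi hs)]
  have : (fun p : (∀ v, X v) × X v => Function.update p.1 v p.2) ⁻¹' Set.univ.pi s =
      (Set.univ.pi (Function.update s v Set.univ)) ×ˢ s v := by
    ext ⟨x, y⟩
    simp only [Set.mem_preimage, Set.mem_pi, Set.mem_univ, true_imp_iff, Set.mem_prod]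
    constructor
    · intro h
      refine ⟨fun w => ?_, by simpa using h v⟩
      by_cases hw : w = v
      · subst hw; simp
      · simpa [Function.update_of_ne hw] using h w
    · rintro ⟨h1, h2⟩ w
      by_cases hw : w = v
      · subst hw; simpa using h2
      · simpa [Function.update_of_ne hw] using h1 w
  rw [this, Measure.prod_prod, Measure.pi_pi, ← Finset.prod_erase_mul _ _ (Finset.mem_univ v),
    ← Finset.prod_erase_mul _ (fun i => μ i (s i)) (Finset.mem_univ v)]
  simp only [Function.update_self, measure_univ, mul_one]
  congr 1
  refine Finset.prod_congr rfl fun w hw => ?_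
  rw [Function.update_of_ne (Finset.ne_of_mem_erase hw)]

/-- A rooted tree on `V`, given by parents and depths. -/
structure RootedTree (V : Type) where
  root : V
  par : V → V
  depth : V → ℕ
  depth_root : depth root = 0
  depth_par : ∀ u, u ≠ root → depth u = depth (par u) + 1

namespace RootedTree

variable {V : Type} [Fintype V] [DecidableEq V] (S : RootedTree V)

/-- The children of a vertex. -/
def children (u : V) : Finset V := Finset.univ.filter fun w => w ≠ S.root ∧ S.par w = u

theorem depth_of_mem_children {u w : V} (h : w ∈ S.children u) : S.depth w = S.depth u + 1 := by
  obtain ⟨h1, rfl⟩ := (Finset.mem_filter.1 h).2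
  exact S.depth_par w h1

theorem induction_children {P : V → Prop} (h : ∀ u, (∀ w ∈ S.children u, P w) → P u) (u : V) :
    P u := by
  have hD : ∀ u, S.depth u ≤ Finset.univ.sup S.depth :=
    fun u => Finset.le_sup (Finset.mem_univ u)
  suffices H : ∀ k u, Finset.univ.sup S.depth ≤ S.depth u + k → P u from
    H _ u (Nat.le_add_left _ _)
  intro k
  induction k with
  | zero =>
    intro u hu
    refine h u fun w hw => ?_
    have h1 := S.depth_of_mem_children hw
    have h2 := hD w
    omega
  | succ k ih =>
    intro u hu
    refine h u fun w hw => ih w ?_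
    have h1 := S.depth_of_mem_children hw
    omega

/-- Iterating `step` from arbitrary values stabilizes from the deepest vertices upwards, after a
number of iterations governed by the height. -/
theorem exists_fixpoint {A : Type} [Inhabited A] (step : V → (V → A) → A)
    (hstep : ∀ u f f', (∀ w ∈ S.children u, f w = f' w) → step u f = step u f') :
    ∃ c : V → A, ∀ u, c u = step u c := by
  let c : ℕ → V → A := fun t => Nat.rec (fun _ => default) (fun _ f u => step u f) t
  have hc : ∀ t u, c (t + 1) u = step u (c t) := fun _ _ => rfl
  have hD : ∀ u, S.depth u ≤ Finset.univ.sup S.depth :=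
    fun u => Finset.le_sup (Finset.mem_univ u)
  have key : ∀ t u, Finset.univ.sup S.depth < S.depth u + t → c (t + 1) u = c t u := by
    intro t
    induction t with
    | zero =>
      intro u hu
      have := hD u
      omega
    | succ t ih =>
      intro u hu
      rw [hc (t + 1) u, hc t u]
      refine hstep _ _ _ fun w hw => ih w ?_
      have := S.depth_of_mem_children hw
      omega
  refine ⟨c (Finset.univ.sup S.depth + 1), fun u => ?_⟩
  exact (key (Finset.univ.sup S.depth + 1) u (by omega)).symm.trans
    (hc (Finset.univ.sup S.depth + 1) u)

/-- Every vertex except the root is a child of exactly one vertex. -/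
theorem sum_children (f : V → ℝ) : ∑ u, ∑ w ∈ S.children u, f w = ∑ w, f w - f S.root := by
  have h : ∀ u, S.children u = (Finset.univ.erase S.root).filter fun w => S.par w = u := by
    intro u
    ext w
    simp [children]
  simp_rw [h]
  rw [Finset.sum_fiberwise]
  rw [eq_sub_iff_add_eq, Finset.sum_erase_add _ _ (Finset.mem_univ _)]

variable (g : ℝ) (a : V → ℝ)

theorem exists_treeCode (θ : V → ℝ) : ∃ c : V → ℕ, ∀ u,
    c u = roundCode g (a u + ∑ w ∈ S.children u, gridVal g (c w)) (θ u) :=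
  S.exists_fixpoint (fun u f => roundCode g (a u + ∑ w ∈ S.children u, gridVal g (f w)) (θ u))
    fun u f f' h => by rw [Finset.sum_congr rfl fun w hw => by rw [h w hw]]

/-- The codes obtained by summing `a` towards the root, with randomized rounding at every vertex. -/
def code (θ : V → ℝ) : V → ℕ := (S.exists_treeCode g a θ).choose

/-- The rounded partial sum at a vertex. -/
def val (u : V) (θ : V → ℝ) : ℝ := gridVal g (S.code g a θ u)

/-- The partial sum at a vertex before it is rounded. -/
def tot (u : V) (θ : V → ℝ) : ℝ := a u + ∑ w ∈ S.children u, S.val g a w θ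

theorem code_eq (θ : V → ℝ) (u : V) :
    S.code g a θ u = roundCode g (S.tot g a u θ) (θ u) :=
  (S.exists_treeCode g a θ).choose_spec u

theorem val_eq (θ : V → ℝ) (u : V) :
    S.val g a u θ = gridVal g (roundCode g (S.tot g a u θ) (θ u)) := by
  rw [val, code_eq]

variable {g a}

theorem val_nonneg (hg : 1 < g) (u : V) (θ : V → ℝ) : 0 ≤ S.val g a u θ := gridVal_nonneg hg _

theorem tot_eq_zero_or (hg : 1 < g) (ha : ∀ u, a u = 0 ∨ 1 ≤ a u) (u : V) (θ : V → ℝ) :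
    S.tot g a u θ = 0 ∨ 1 ≤ S.tot g a u θ := by
  have h0 : 0 ≤ ∑ w ∈ S.children u, S.val g a w θ :=
    Finset.sum_nonneg fun w _ => S.val_nonneg hg w θ
  rcases ha u with h | h
  · by_cases h1 : ∀ w ∈ S.children u, S.val g a w θ = 0
    · left
      rw [tot, h, Finset.sum_eq_zero h1, add_zero]
    · right
      push Not at h1
      obtain ⟨w, hw, hw0⟩ := h1
      have h2 : 1 ≤ S.val g a w θ := (gridVal_eq_zero_or hg _).resolve_left hw0
      have h3 := Finset.single_le_sum (f := fun w => S.val g a w θ)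
        (fun w _ => S.val_nonneg hg w θ) hw
      rw [tot, h, zero_add]
      exact h2.trans h3
  · right
    rw [tot]
    linarith

theorem measurable_code (u : V) : Measurable fun θ => S.code g a θ u := by
  refine S.induction_children (P := fun u => Measurable fun θ => S.code g a θ u) ?_ u
  intro u ih
  have h1 : Measurable (S.tot g a u) := by
    refine measurable_const.add (Finset.measurable_fun_sum _ fun w hw => ?_)
    exact (measurable_from_top (f := gridVal g)).comp (ih w hw)
  simp_rw [code_eq]
  exact (measurable_roundCode g).comp (h1.prodMk (measurable_pi_apply u))

theorem measurable_val (u : V) : Measurable (S.val g a u) :=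
  (measurable_from_top (f := gridVal g)).comp (S.measurable_code u)

theorem measurable_tot (u : V) : Measurable (S.tot g a u) :=
  measurable_const.add (Finset.measurable_fun_sum _ fun w _ => S.measurable_val w)

/-- The bound is qualitative and serves only integrability. -/
theorem exists_val_le (hg : 1 < g) (ha : ∀ u, a u = 0 ∨ 1 ≤ a u) (u : V) :
    ∃ K, ∀ θ, S.val g a u θ ≤ K := by
  refine S.induction_children (P := fun u => ∃ K, ∀ θ, S.val g a u θ ≤ K) ?_ u
  intro u ih
  choose! K hK using ih
  refine ⟨g * (a u + ∑ w ∈ S.children u, K w), fun θ => ?_⟩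
  have h0 : 0 ≤ S.tot g a u θ := by
    rcases S.tot_eq_zero_or hg ha u θ with h | h <;> linarith
  rw [val_eq]
  refine (gridVal_roundCode_le hg h0 _).trans (mul_le_mul_of_nonneg_left ?_ (by linarith))
  rw [tot]
  gcongr with w hw
  exact hK w hw θ

/-- The law of the thresholds. -/
abbrev thresholdLaw (V : Type) [Fintype V] : Measure (V → ℝ) := Measure.pi fun _ : V => unif

theorem memLp_val (hg : 1 < g) (ha : ∀ u, a u = 0 ∨ 1 ≤ a u) (u : V) (p : ENNReal) :
    MemLp (S.val g a u) p (thresholdLaw V) := by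
  obtain ⟨K, hK⟩ := S.exists_val_le hg ha u
  refine MemLp.of_bound (S.measurable_val u).aestronglyMeasurable K (ae_of_all _ fun θ => ?_)
  rw [Real.norm_of_nonneg (S.val_nonneg hg u θ)]
  exact hK θ

theorem memLp_tot (hg : 1 < g) (ha : ∀ u, a u = 0 ∨ 1 ≤ a u) (u : V) (p : ENNReal) :
    MemLp (S.tot g a u) p (thresholdLaw V) := by
  have h1 : MemLp (fun θ => ∑ w ∈ S.children u, S.val g a w θ) p (thresholdLaw V) :=
    memLp_finsetSum _ fun w _ => S.memLp_val hg ha w p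
  have h2 : MemLp (fun _ => a u) p (thresholdLaw V) := memLp_const _
  exact h2.add h1

/-- A value depends only on the thresholds in its own subtree, whose other vertices are strictly
deeper; comparing depths avoids speaking of subtrees. -/
theorem val_update (θ : V → ℝ) (x : ℝ) (u : V) : ∀ v, S.depth v ≤ S.depth u → v ≠ u →
    S.val g a u (Function.update θ v x) = S.val g a u θ := by
  refine S.induction_children (P := fun u => ∀ v, S.depth v ≤ S.depth u → v ≠ u →
    S.val g a u (Function.update θ v x) = S.val g a u θ) ?_ u
  intro u ih v hv hvu
  rw [val_eq, val_eq, tot, tot, Function.update_of_ne hvu.symm, Finset.sum_congr rfl fun w hw => ?_]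
  have := S.depth_of_mem_children hw
  exact ih w hw v (by omega) (by rintro rfl; omega)

theorem tot_update (θ : V → ℝ) (x : ℝ) (u v : V) (hv : S.depth v ≤ S.depth u) :
    S.tot g a u (Function.update θ v x) = S.tot g a u θ := by
  rw [tot, tot, Finset.sum_congr rfl fun w hw => ?_]
  have := S.depth_of_mem_children hw
  exact S.val_update θ x w v (by omega) (by rintro rfl; omega)

theorem integral_resample {F : (V → ℝ) → ℝ} (hF : Integrable F (thresholdLaw V)) (v : V) :
    ∫ θ, F θ ∂thresholdLaw V = ∫ θ, ∫ x, F (Function.update θ v x) ∂unif ∂thresholdLaw V := by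
  have hmp := measurePreserving_update (fun _ : V => unif) v
  rw [← integral_prod (fun p : (V → ℝ) × ℝ => F (Function.update p.1 v p.2))
    (hmp.integrable_comp_of_integrable hF)]
  conv_lhs => rw [thresholdLaw, ← hmp.map_eq]
  rw [integral_map hmp.measurable.aemeasurable (by rw [hmp.map_eq]; exact hF.aestronglyMeasurable)]

/-- Given all thresholds except the one at `u`, the rounding at `u` is unbiased and `h` is constant.
Resampling that coordinate takes the place of a conditional expectation. -/
theorem integral_val_mul (hg : 1 < g) (ha : ∀ u, a u = 0 ∨ 1 ≤ a u) (u : V) {h : (V → ℝ) → ℝ}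
    (hh : MemLp h 2 (thresholdLaw V)) (hinv : ∀ θ x, h (Function.update θ u x) = h θ) :
    ∫ θ, S.val g a u θ * h θ ∂thresholdLaw V = ∫ θ, S.tot g a u θ * h θ ∂thresholdLaw V := by
  rw [integral_resample (F := fun θ => S.val g a u θ * h θ)
    ((S.memLp_val hg ha u 2).integrable_mul hh) u]
  congr 1
  funext θ
  simp_rw [val_eq, S.tot_update _ _ u u le_rfl, hinv, Function.update_self]
  rw [integral_mul_const, integral_gridVal_roundCode hg (S.tot_eq_zero_or hg ha u θ)]

theorem integral_val (hg : 1 < g) (ha : ∀ u, a u = 0 ∨ 1 ≤ a u) (u : V) :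
    ∫ θ, S.val g a u θ ∂thresholdLaw V = ∫ θ, S.tot g a u θ ∂thresholdLaw V := by
  simpa using S.integral_val_mul hg ha u (h := fun _ => 1) (memLp_const _) (fun _ _ => rfl)

theorem integral_tot (hg : 1 < g) (ha : ∀ u, a u = 0 ∨ 1 ≤ a u) (u : V) :
    ∫ θ, S.tot g a u θ ∂thresholdLaw V =
      a u + ∑ w ∈ S.children u, ∫ θ, S.val g a w θ ∂thresholdLaw V := by
  have hi : ∀ w, Integrable (S.val g a w) (thresholdLaw V) := fun w =>
    (S.memLp_val hg ha w 1).integrable le_rfl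
  simp only [tot]
  rw [integral_add (integrable_const _) (integrable_finsetSum _ fun w _ => hi w),
    integral_finsetSum _ fun w _ => hi w]
  simp

theorem covariance_tot (hg : 1 < g) (ha : ∀ u, a u = 0 ∨ 1 ≤ a u) (u v : V) :
    cov[S.tot g a u, S.tot g a v; thresholdLaw V] =
      ∑ w ∈ S.children u, ∑ w' ∈ S.children v, cov[S.val g a w, S.val g a w'; thresholdLaw V] := by
  have hi : ∀ u, MemLp (fun θ => ∑ w ∈ S.children u, S.val g a w θ) 2 (thresholdLaw V) :=
    fun u => memLp_finsetSum _ fun w _ => S.memLp_val hg ha w 2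
  have h1 : ∀ u, S.tot g a u = fun θ => a u + ∑ w ∈ S.children u, S.val g a w θ := fun _ => rfl
  rw [h1 u, h1 v, covariance_const_add_left ((hi u).integrable (by norm_num)),
    covariance_const_add_right ((hi v).integrable (by norm_num))]
  exact covariance_fun_sum_fun_sum' (fun w _ => S.memLp_val hg ha w 2)
    (fun w _ => S.memLp_val hg ha w 2)

/-- Unbiasedness removes both roundings, so the covariance equals that of the unrounded sums. It
expands over pairs of children, which are again distinct, having different parents, and of equal
depth. Induction from the leaves concludes. -/
theorem covariance_val (hg : 1 < g) (ha : ∀ u, a u = 0 ∨ 1 ≤ a u) (u : V) :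
    ∀ v, v ≠ u → S.depth v = S.depth u →
      cov[S.val g a u, S.val g a v; thresholdLaw V] = 0 := by
  refine S.induction_children (P := fun u => ∀ v, v ≠ u → S.depth v = S.depth u →
      cov[S.val g a u, S.val g a v; thresholdLaw V] = 0) ?_ u
  intro u ih v hvu hd
  have h1 : cov[S.val g a u, S.val g a v; thresholdLaw V] =
      cov[S.tot g a u, S.tot g a v; thresholdLaw V] := by
    rw [covariance_eq_sub (S.memLp_val hg ha u 2) (S.memLp_val hg ha v 2),
      covariance_eq_sub (S.memLp_tot hg ha u 2) (S.memLp_tot hg ha v 2),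
      S.integral_val hg ha u, S.integral_val hg ha v]
    congr 1
    change ∫ θ, S.val g a u θ * S.val g a v θ ∂thresholdLaw V =
      ∫ θ, S.tot g a u θ * S.tot g a v θ ∂thresholdLaw V
    rw [S.integral_val_mul hg ha u (S.memLp_val hg ha v 2)
      (fun θ x => S.val_update θ x v u hd.ge hvu.symm)]
    simp_rw [mul_comm (S.tot g a u _)]
    rw [S.integral_val_mul hg ha v (S.memLp_tot hg ha u 2)
      (fun θ x => S.tot_update θ x u v hd.le)]
  rw [h1, S.covariance_tot hg ha]
  refine Finset.sum_eq_zero fun w hw => Finset.sum_eq_zero fun w' hw' => ?_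
  refine ih w hw w' ?_ ?_
  · rintro rfl
    exact hvu ((Finset.mem_filter.1 hw').2.2.symm.trans (Finset.mem_filter.1 hw).2.2)
  · rw [S.depth_of_mem_children hw, S.depth_of_mem_children hw', hd]

theorem variance_tot (hg : 1 < g) (ha : ∀ u, a u = 0 ∨ 1 ≤ a u) (u : V) :
    Var[S.tot g a u; thresholdLaw V] =
      ∑ w ∈ S.children u, Var[S.val g a w; thresholdLaw V] := by
  rw [← covariance_self (S.measurable_tot u).aemeasurable, S.covariance_tot hg ha]
  refine Finset.sum_congr rfl fun w hw => ?_
  rw [← covariance_self (S.measurable_val w).aemeasurable]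
  refine Finset.sum_eq_single_of_mem w hw fun w' hw' hne => ?_
  exact S.covariance_val hg ha w w' hne
    (by rw [S.depth_of_mem_children hw, S.depth_of_mem_children hw'])

/-- The rounding bound is used with the largest child value `v` as the grid value. The squares of
the children's values add up to at most `v` times their sum, hence to at most `v` times the total
`s`, which turns the term `-(g - 1) * s * v` into a sum over the children. -/
theorem integral_resample_val_sq_le (hg : 1 < g) (ha : ∀ u, a u = 0 ∨ 1 ≤ a u) (u : V)
    (θ : V → ℝ) :
    ∫ x, S.val g a u (Function.update θ u x) ^ 2 ∂unif ≤
      g * S.tot g a u θ ^ 2 - (g - 1) * ∑ w ∈ S.children u, S.val g a w θ ^ 2 := by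
  simp_rw [val_eq S g a _ u, S.tot_update _ _ u u le_rfl, Function.update_self]
  have h0 : 0 ≤ a u := by rcases ha u with h | h <;> linarith
  have hsum : ∑ w ∈ S.children u, S.val g a w θ ≤ S.tot g a u θ := by
    rw [tot]; linarith
  obtain ⟨c, hc, hcw⟩ : ∃ c, gridVal g c ≤ S.tot g a u θ ∧
      ∀ w ∈ S.children u, S.val g a w θ ≤ gridVal g c := by
    rcases (S.children u).eq_empty_or_nonempty with he | hne
    · refine ⟨0, ?_, by simp [he]⟩
      rcases S.tot_eq_zero_or hg ha u θ with h | h <;> simp [gridVal] <;> linarith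
    · obtain ⟨w, hw, hmax⟩ := (S.children u).exists_max_image (fun w => S.val g a w θ) hne
      refine ⟨S.code g a θ w, ?_, hmax⟩
      exact (Finset.single_le_sum (f := fun w => S.val g a w θ)
        (fun w _ => S.val_nonneg hg w θ) hw).trans hsum
  refine (integral_gridVal_roundCode_sq_le hg (S.tot_eq_zero_or hg ha u θ) hc).trans ?_
  have h1 : ∑ w ∈ S.children u, S.val g a w θ ^ 2 ≤ S.tot g a u θ * gridVal g c := by
    calc ∑ w ∈ S.children u, S.val g a w θ ^ 2
        ≤ ∑ w ∈ S.children u, S.val g a w θ * gridVal g c := by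
          refine Finset.sum_le_sum fun w hw => ?_
          rw [sq]
          exact mul_le_mul_of_nonneg_left (hcw w hw) (S.val_nonneg hg w θ)
      _ = (∑ w ∈ S.children u, S.val g a w θ) * gridVal g c := by rw [Finset.sum_mul]
      _ ≤ _ := mul_le_mul_of_nonneg_right hsum (gridVal_nonneg hg c)
  nlinarith

/-- The rounded sum at a vertex has relative variance at most `g - 1`, whatever the tree. -/
theorem variance_val_le (hg : 1 < g) (ha : ∀ u, a u = 0 ∨ 1 ≤ a u) (u : V) :
    Var[S.val g a u; thresholdLaw V] ≤
      (g - 1) * (∫ θ, S.val g a u θ ∂thresholdLaw V) ^ 2 := by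
  refine S.induction_children (P := fun u => Var[S.val g a u; thresholdLaw V] ≤
      (g - 1) * (∫ θ, S.val g a u θ ∂thresholdLaw V) ^ 2) ?_ u
  intro u ih
  have hsq : ∀ u, Integrable (fun θ => S.val g a u θ ^ 2) (thresholdLaw V) :=
    fun u => (S.memLp_val hg ha u 2).integrable_sq
  have htq : Integrable (fun θ => S.tot g a u θ ^ 2) (thresholdLaw V) :=
    (S.memLp_tot hg ha u 2).integrable_sq
  have hsum : Integrable (fun θ => ∑ w ∈ S.children u, S.val g a w θ ^ 2) (thresholdLaw V) :=
    integrable_finsetSum _ fun w _ => hsq w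
  have h1 : ∫ θ, S.val g a u θ ^ 2 ∂thresholdLaw V ≤
      g * ∫ θ, S.tot g a u θ ^ 2 ∂thresholdLaw V -
        (g - 1) * ∑ w ∈ S.children u, ∫ θ, S.val g a w θ ^ 2 ∂thresholdLaw V := by
    rw [integral_resample (hsq u) u, ← integral_finsetSum _ fun w _ => hsq w,
      ← integral_const_mul, ← integral_const_mul,
      ← integral_sub (htq.const_mul _) (hsum.const_mul _)]
    refine integral_mono ?_ ((htq.const_mul _).sub (hsum.const_mul _))
      (S.integral_resample_val_sq_le hg ha u)
    exact ((measurePreserving_update (fun _ : V => unif) u).integrable_comp_of_integrable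
      (hsq u)).integral_prod_left
  have hv : ∀ w, ∫ θ, S.val g a w θ ^ 2 ∂thresholdLaw V =
      Var[S.val g a w; thresholdLaw V] + (∫ θ, S.val g a w θ ∂thresholdLaw V) ^ 2 := by
    intro w
    rw [variance_eq_sub (S.memLp_val hg ha w 2)]
    simp
  have ht : ∫ θ, S.tot g a u θ ^ 2 ∂thresholdLaw V =
      ∑ w ∈ S.children u, Var[S.val g a w; thresholdLaw V] +
        (∫ θ, S.val g a u θ ∂thresholdLaw V) ^ 2 := by
    rw [← S.variance_tot hg ha u, variance_eq_sub (S.memLp_tot hg ha u 2), S.integral_val hg ha u]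
    simp
  rw [hv u, ht] at h1
  simp_rw [hv] at h1
  have h2 := Finset.sum_le_sum ih
  rw [← Finset.mul_sum] at h2
  rw [Finset.sum_add_distrib] at h1
  -- Writing second moments as variance plus squared mean, the children's variances enter with
  -- coefficient `g - (g - 1) = 1` and their squared means with `-(g - 1)`. The induction hypothesis
  -- cancels the two, and `(g - 1)` times the squared mean at `u` remains.
  nlinarith

theorem integral_val_root (hg : 1 < g) (ha : ∀ u, a u = 0 ∨ 1 ≤ a u) :
    ∫ θ, S.val g a S.root θ ∂thresholdLaw V = ∑ u, a u := by
  have h := S.sum_children fun w => ∫ θ, S.val g a w θ ∂thresholdLaw V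
  have h1 : ∑ u, ∫ θ, S.val g a u θ ∂thresholdLaw V =
      ∑ u, a u + ∑ u, ∑ w ∈ S.children u, ∫ θ, S.val g a w θ ∂thresholdLaw V := by
    rw [← Finset.sum_add_distrib]
    exact Finset.sum_congr rfl fun u _ => by rw [S.integral_val hg ha, S.integral_tot hg ha]
  linarith

/-- Means can only grow towards the root, where the mean is the full sum. -/
theorem integral_val_le (hg : 1 < g) (ha : ∀ u, a u = 0 ∨ 1 ≤ a u) (u : V) :
    ∫ θ, S.val g a u θ ∂thresholdLaw V ≤ ∑ u, a u := by
  suffices H : ∀ k u, S.depth u = k → ∫ θ, S.val g a u θ ∂thresholdLaw V ≤ ∑ u, a u from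
    H _ u rfl
  intro k
  induction k with
  | zero =>
    intro u hu
    by_cases h : u = S.root
    · rw [h, S.integral_val_root hg ha]
    · have := S.depth_par u h
      omega
  | succ k ih =>
    intro u hu
    have h : u ≠ S.root := by
      rintro rfl
      rw [S.depth_root] at hu
      omega
    refine le_trans ?_ (ih (S.par u) (by have := S.depth_par u h; omega))
    rw [S.integral_val hg ha (S.par u), S.integral_tot hg ha]
    have h0 : 0 ≤ a (S.par u) := by rcases ha (S.par u) with h | h <;> linarith
    have h1 := Finset.single_le_sum (f := fun w => ∫ θ, S.val g a w θ ∂thresholdLaw V)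
      (fun w _ => integral_nonneg (S.val_nonneg hg w))
      (show u ∈ S.children (S.par u) from Finset.mem_filter.2 ⟨Finset.mem_univ _, h, rfl⟩)
    linarith

/-- With high probability the rounded sum at the root is accurate. -/
theorem measureReal_val_root_le (hg : 1 < g) (ha : ∀ u, a u = 0 ∨ 1 ≤ a u) {η : ℝ} (hη : 0 < η) :
    (thresholdLaw V).real {θ | η * (∑ u, a u) < |S.val g a S.root θ - ∑ u, a u|} ≤
      (g - 1) / η ^ 2 := by
  have hT0 : 0 ≤ ∑ u, a u := Finset.sum_nonneg fun u _ => by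
    rcases ha u with h | h <;> linarith
  -- A vanishing total is separated because Chebyshev's inequality needs a positive deviation; in
  -- that case all values are exactly zero.
  rcases hT0.eq_or_lt with h0 | hpos
  · have h1 : ∀ u, a u = 0 := by
      intro u
      refine (Finset.sum_eq_zero_iff_of_nonneg fun u _ => ?_).1 h0.symm u (Finset.mem_univ u)
      rcases ha u with h | h <;> linarith
    have h2 : ∀ u, ∀ θ, S.val g a u θ = 0 := by
      refine S.induction_children fun u ih θ => ?_
      have : S.tot g a u θ = 0 := by
        rw [tot, h1, Finset.sum_eq_zero fun w hw => ih w hw θ, add_zero]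
      rw [val_eq, this]
      simp [roundCode, gridVal]
    simp only [← h0, h2]
    simp only [mul_zero, sub_zero, abs_zero, lt_self_iff_false, Set.ofPred_false, measureReal_empty]
    exact div_nonneg (by linarith) (sq_nonneg _)
  · have h := meas_ge_le_variance_div_sq (S.memLp_val hg ha S.root 2) (mul_pos hη hpos)
    rw [S.integral_val_root hg ha] at h
    have h1 : (thresholdLaw V).real {θ | η * (∑ u, a u) < |S.val g a S.root θ - ∑ u, a u|} ≤
        Var[S.val g a S.root; thresholdLaw V] / (η * ∑ u, a u) ^ 2 := by
      refine ENNReal.toReal_le_of_le_ofReal (div_nonneg (variance_nonneg _ _) (sq_nonneg _)) ?_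
      refine le_trans (measure_mono fun θ hθ => ?_) h
      rw [Set.mem_ofPred_eq] at hθ ⊢
      exact hθ.le
    refine h1.trans ?_
    rw [mul_pow, div_le_div_iff₀ (by positivity) (by positivity)]
    have h2 := S.variance_val_le hg ha S.root
    rw [S.integral_val_root hg ha] at h2
    nlinarith [mul_le_mul_of_nonneg_right h2 (sq_nonneg η)]

/-- With high probability no rounded sum is large. -/
theorem measureReal_exists_val_ge_le (hg : 1 < g) (ha : ∀ u, a u = 0 ∨ 1 ≤ a u) {R : ℝ}
    (hR : 0 < R) :
    (thresholdLaw V).real {θ | ∃ u, R ≤ S.val g a u θ} ≤ Fintype.card V * (∑ u, a u) / R := by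
  have h1 : ∀ u, (thresholdLaw V).real {θ | R ≤ S.val g a u θ} ≤ (∑ u, a u) / R := by
    intro u
    have h := mul_meas_ge_le_integral_of_nonneg (μ := thresholdLaw V)
      (ae_of_all _ (S.val_nonneg hg u)) ((S.memLp_val hg ha u 1).integrable le_rfl) R
    rw [le_div_iff₀ hR, mul_comm]
    exact h.trans (S.integral_val_le hg ha u)
  have h2 : {θ | ∃ u, R ≤ S.val g a u θ} = ⋃ u ∈ (Finset.univ : Finset V),
      {θ | R ≤ S.val g a u θ} := by
    ext θ; simp
  rw [h2]
  refine (measureReal_biUnion_finset_le _ _).trans ?_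
  refine (Finset.sum_le_sum fun u _ => h1 u).trans ?_
  rw [Finset.sum_const, nsmul_eq_mul, Finset.card_univ, mul_div_assoc]

end RootedTree

/-! ### A random variable whose log-Laplace transform is close to `t log t` -/

/-- A jump `E / v`, where `E = |log u|` is exponential and the rate `v = r x` is uniform on `[0, r]`,
restricted to rates with `x ∈ [b, a]`. -/
def jump (r b a : ℝ) (p : ℝ × ℝ) : ℝ :=
  if p.1 ∈ Set.Icc b a then |Real.log p.2| / (r * p.1) else 0

theorem measurable_jump (r b a : ℝ) : Measurable (jump r b a) := by
  refine Measurable.ite (measurable_fst measurableSet_Icc) ?_ measurable_const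
  exact (continuous_abs.measurable.comp (Real.measurable_log.comp measurable_snd)).div
    (measurable_const.mul measurable_fst)

theorem jump_nonneg {r b a : ℝ} (hr : 0 < r) (hb : 0 < b) (p : ℝ × ℝ) : 0 ≤ jump r b a p := by
  unfold jump
  split_ifs with h
  · have : 0 < p.1 := hb.trans_le h.1
    positivity
  · exact le_rfl

theorem integral_unif_indicator {b a : ℝ} (hb : 0 < b) (hba : b ≤ a) (ha : a ≤ 1) (h : ℝ → ℝ) :
    ∫ x, (Set.Icc b a).indicator h x ∂unif = ∫ x in b..a, h x := by
  have hsub : Set.Icc b a ⊆ Set.Ioc 0 1 := fun x hx => ⟨hb.trans_le hx.1, hx.2.trans ha⟩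
  rw [integral_indicator measurableSet_Icc, unif, Measure.restrict_restrict measurableSet_Icc,
    Set.inter_eq_left.2 hsub,
    integral_Icc_eq_integral_Ioc, intervalIntegral.integral_of_le hba]

theorem integral_unif_eq (h : ℝ → ℝ) : ∫ x, h x ∂unif = ∫ x in (0:ℝ)..1, h x := by
  rw [unif, intervalIntegral.integral_of_le zero_le_one]

theorem ae_unif : ∀ᵐ x ∂unif, x ∈ Set.Ioc (0:ℝ) 1 := ae_restrict_mem measurableSet_Ioc

theorem integral_exp_neg_mul_abs_log {s : ℝ} (hs : 0 ≤ s) :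
    ∫ u, Real.exp (-(s * |Real.log u|)) ∂unif = 1 / (s + 1) := by
  have h1 : ∫ u, Real.exp (-(s * |Real.log u|)) ∂unif = ∫ u, u ^ s ∂unif := by
    refine integral_congr_ae ?_
    filter_upwards [ae_unif] with u hu
    rw [abs_of_nonpos (Real.log_nonpos hu.1.le hu.2), Real.rpow_def_of_pos hu.1]
    congr 1
    ring
  rw [h1, integral_unif_eq, integral_rpow (Or.inl (by linarith))]
  simp [Real.zero_rpow (by linarith : s + 1 ≠ 0)]

theorem integrable_abs_log : Integrable (fun u => |Real.log u|) unif := by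
  have : IntervalIntegrable Real.log volume 0 1 := intervalIntegral.intervalIntegrable_log'
  exact ((intervalIntegrable_iff_integrableOn_Ioc_of_le zero_le_one).1 this).abs

theorem integral_abs_log : ∫ u, |Real.log u| ∂unif = 1 := by
  have h1 : ∫ u, |Real.log u| ∂unif = ∫ u, -Real.log u ∂unif := by
    refine integral_congr_ae ?_
    filter_upwards [ae_unif] with u hu
    rw [abs_of_nonpos (Real.log_nonpos hu.1.le hu.2)]
  rw [h1, integral_neg, integral_unif_eq, integral_log]
  simp

theorem integrable_jump {r b a : ℝ} (hr : 0 < r) (hb : 0 < b) :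
    Integrable (jump r b a) (unif.prod unif) := by
  have h1 : Integrable (fun p : ℝ × ℝ => |Real.log p.2| / (r * b)) (unif.prod unif) :=
    (integrable_abs_log.div_const (r * b)).comp_snd unif
  refine h1.mono' (measurable_jump r b a).aestronglyMeasurable (ae_of_all _ fun p => ?_)
  rw [Real.norm_of_nonneg (jump_nonneg hr hb p), jump]
  split_ifs with h
  · have := h.1
    gcongr
  · positivity

theorem integral_jump {r b a : ℝ} (hr : 0 < r) (hb : 0 < b) (hba : b ≤ a) (ha : a ≤ 1) :
    ∫ p, jump r b a p ∂unif.prod unif = Real.log (a / b) / r := by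
  rw [integral_prod _ (integrable_jump hr hb)]
  have h1 : ∀ x, ∫ u, jump r b a (x, u) ∂unif =
      (Set.Icc b a).indicator (fun x => r⁻¹ * x⁻¹) x := by
    intro x
    by_cases hx : x ∈ Set.Icc b a
    · simp only [jump, hx, if_true, Set.indicator_of_mem]
      rw [integral_div, integral_abs_log]
      simp [mul_comm]
    · simp [jump, hx]
  simp_rw [h1]
  rw [integral_unif_indicator hb hba ha, intervalIntegral.integral_const_mul,
    integral_inv_of_pos hb (hb.trans_le hba)]
  ring

/-- An exponential jump of rate `v` has transform `v / (v + t) = 1 - t / (v + t)`, and integrating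
`t / (v + t)` over the rates produces the logarithms. For `b = β / r`, `a = α / r` and large `r`,
the `r`-th power is close to `exp (-t * (log (α + t) - log (β + t)))`, which for `β ≪ t ≪ α` is
close to `exp (t log t - t log α)`. -/
theorem integral_exp_neg_jump {r b a t : ℝ} (hr : 0 < r) (hb : 0 < b) (hba : b ≤ a) (ha : a ≤ 1)
    (ht : 0 ≤ t) :
    ∫ p, Real.exp (-(t * jump r b a p)) ∂unif.prod unif =
      1 - t * (Real.log (r * a + t) - Real.log (r * b + t)) / r := by
  have hint : Integrable (fun p => Real.exp (-(t * jump r b a p))) (unif.prod unif) := by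
    refine Integrable.of_bound (C := 1) (Real.measurable_exp.comp
      ((measurable_jump r b a).const_mul t).neg).aestronglyMeasurable (ae_of_all _ fun p => ?_)
    rw [Real.norm_of_nonneg (Real.exp_pos _).le, Real.exp_le_one_iff]
    have := mul_nonneg ht (jump_nonneg (a := a) hr hb p)
    linarith
  rw [integral_prod _ hint]
  have h1 : ∀ x, ∫ u, Real.exp (-(t * jump r b a (x, u))) ∂unif =
      1 - (Set.Icc b a).indicator (fun x => t / (r * x + t)) x := by
    intro x
    by_cases hx : x ∈ Set.Icc b a
    · have hx0 : 0 < x := hb.trans_le hx.1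
      simp only [jump, hx, if_true, Set.indicator_of_mem]
      have h2 : ∀ u, t * (|Real.log u| / (r * x)) = (t / (r * x)) * |Real.log u| := fun u => by ring
      simp_rw [h2]
      rw [integral_exp_neg_mul_abs_log (by positivity)]
      field_simp
      ring
    · simp [jump, hx]
  have h3 : ∀ x ∈ Set.uIcc b a, 0 < r * x + t := by
    intro x hx
    rw [Set.uIcc_of_le hba] at hx
    have : 0 < x := hb.trans_le hx.1
    positivity
  have hcont : ContinuousOn (fun x => t / (r * x + t)) (Set.uIcc b a) :=
    continuousOn_const.div (by fun_prop) fun x hx => (h3 x hx).ne'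
  have h2 : ∫ x in b..a, t / (r * x + t) = t * (Real.log (r * a + t) - Real.log (r * b + t)) / r := by
    rw [intervalIntegral.integral_eq_sub_of_hasDerivAt (f := fun x => t / r * Real.log (r * x + t))
      ?_ hcont.intervalIntegrable]
    · ring
    · intro x hx
      have hd : HasDerivAt (fun x => r * x + t) r x := by
        simpa using ((hasDerivAt_id x).const_mul r).add_const t
      convert! (hd.log (h3 x hx).ne').const_mul (t / r) using 1
      field_simp
  simp_rw [h1]
  rw [integral_sub (integrable_const _), integral_unif_indicator hb hba ha, h2]
  · simp
  · rw [integrable_indicator_iff measurableSet_Icc, unif]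
    rw [Set.uIcc_of_le hba] at hcont
    exact (hcont.integrableOn_Icc (μ := volume)).mono_measure
      Measure.restrict_le_self

theorem mul_log_one_sub_bounds {r ψ : ℝ} (hr : 0 < r) (hψ : 0 ≤ ψ) (h : ψ / r ≤ 1 / 2) :
    -ψ - 2 * ψ ^ 2 / r ≤ r * Real.log (1 - ψ / r) ∧ r * Real.log (1 - ψ / r) ≤ -ψ := by
  have hy : 0 ≤ ψ / r := by positivity
  set y := ψ / r with hyd
  have hψy : ψ = r * y := by rw [hyd]; field_simp
  have hp : 0 < 1 - y := by linarith
  constructor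
  · have h1 := Real.one_sub_inv_le_log_of_pos hp
    have h2 : -y - 2 * y ^ 2 ≤ 1 - (1 - y)⁻¹ := by
      have : (1 - y)⁻¹ ≤ 1 + y + 2 * y ^ 2 := by
        rw [inv_le_iff_one_le_mul₀ hp]
        nlinarith [mul_nonneg hy (mul_nonneg hy (by linarith : (0:ℝ) ≤ 1 - 2 * y))]
      linarith
    have h3 : -ψ - 2 * ψ ^ 2 / r = r * (-y - 2 * y ^ 2) := by
      rw [hψy]; field_simp
    rw [h3]
    exact mul_le_mul_of_nonneg_left (h2.trans h1) hr.le
  · have h1 := Real.log_le_sub_one_of_pos hp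
    rw [hψy]
    nlinarith

/-- A nonnegative random variable whose logarithmic Laplace transform is, up to a small relative
error, `t log t` minus a linear term. -/
theorem exists_entropySketch {N τ : ℝ} (hN : 1 ≤ N) (hτ : 0 < τ) (hτ1 : τ ≤ 1) :
    ∃ (Ω : Type) (_ : MeasurableSpace Ω) (μ : Measure Ω) (_ : IsProbabilityMeasure μ) (Z : Ω → ℝ),
      Measurable Z ∧ (∀ ω, 0 ≤ Z ω) ∧ Integrable Z μ ∧ ∫ ω, Z ω ∂μ = Real.log (2 * N / τ ^ 2) ∧
      ∀ t, 1 / N ≤ t → t ≤ 2 → 0 < ∫ ω, Real.exp (-(t * Z ω)) ∂μ ∧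
        |Real.log (∫ ω, Real.exp (-(t * Z ω)) ∂μ) - (t * Real.log t - t * Real.log (2 / τ))| ≤
          2 * τ * t := by
  have hN0 : 0 < N := by linarith
  set α := 2 / τ with hα
  set β := τ / N with hβ
  have hα0 : 0 < α := by positivity
  have hβ0 : 0 < β := by positivity
  have hβα : β ≤ α := by
    have h1 : β ≤ τ := div_le_self hτ.le hN
    have h2 : 2 ≤ α := by rw [hα, le_div_iff₀ hτ]; linarith
    linarith
  set K := Real.log ((α + 2) / β) with hK
  have hK0 : 0 ≤ K := Real.log_nonneg (by rw [le_div_iff₀ hβ0]; linarith)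
  -- The three summands ensure that `α / r ≤ 1`, that `ψ / r ≤ 1 / 2` (as `ψ ≤ 2 * K`), and that the
  -- quadratic error `2 * ψ ^ 2 / r` is at most `τ * t`.
  obtain ⟨r, hr⟩ := exists_nat_ge (α + 4 * K + 4 * K ^ 2 / τ)
  have hKτ : 0 ≤ 4 * K ^ 2 / τ := by positivity
  have hr0 : 0 < (r : ℝ) := by linarith
  have hra : α ≤ r := by linarith
  have hr4 : 4 * K ≤ r := by linarith
  have hrK : 4 * K ^ 2 / τ ≤ r := by linarith
  have hb : 0 < β / r := by positivity
  have hba : β / r ≤ α / r := by gcongr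
  have ha1 : α / r ≤ 1 := (div_le_one hr0).2 hra
  set Y := jump r (β / r) (α / r) with hY
  have hYm : Measurable Y := measurable_jump _ _ _
  have hYi : Integrable Y (unif.prod unif) := integrable_jump hr0 hb
  refine ⟨Fin r → ℝ × ℝ, inferInstance, Measure.pi fun _ => unif.prod unif, inferInstance,
    fun ω => ∑ l, Y (ω l), ?_, ?_, ?_, ?_, ?_⟩
  · exact Finset.measurable_fun_sum _ fun l _ => hYm.comp (measurable_pi_apply l)
  · exact fun ω => Finset.sum_nonneg fun l _ => jump_nonneg hr0 hb _
  · exact integrable_finsetSum _ fun l _ => integrable_comp_eval (μ := fun _ : Fin r => unif.prod unif) (i := l) hYi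
  · rw [integral_finsetSum _ fun l _ => integrable_comp_eval (μ := fun _ : Fin r => unif.prod unif) (i := l) hYi]
    have h1 : ∀ l : Fin r, ∫ ω, Y (ω l) ∂(Measure.pi fun _ : Fin r => unif.prod unif) =
        Real.log (α / r / (β / r)) / r := by
      intro l
      rw [integral_comp_eval (μ := fun _ : Fin r => unif.prod unif) hYm.aestronglyMeasurable]
      exact integral_jump hr0 hb hba ha1
    rw [Finset.sum_congr rfl fun l _ => h1 l]
    simp only [Finset.sum_const, Finset.card_univ, Fintype.card_fin, nsmul_eq_mul]
    rw [mul_div_cancel₀ _ hr0.ne']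
    congr 1
    rw [hα, hβ]
    field_simp
  · intro t ht1 ht2
    have ht0 : 0 < t := lt_of_lt_of_le (by positivity) ht1
    set ψ := t * (Real.log (α + t) - Real.log (β + t)) with hψ
    have hφ : ∫ ω, Real.exp (-(t * ∑ l, Y (ω l))) ∂(Measure.pi fun _ : Fin r => unif.prod unif) =
        (1 - ψ / r) ^ r := by
      have h1 : ∀ ω : Fin r → ℝ × ℝ, Real.exp (-(t * ∑ l, Y (ω l))) =
          ∏ l, Real.exp (-(t * Y (ω l))) := by
        intro ω
        rw [← Real.exp_sum, Finset.mul_sum, Finset.sum_neg_distrib]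
      simp_rw [h1]
      rw [integral_fintype_prod_eq_pow (ι := Fin r) (fun p => Real.exp (-(t * Y p))), Fintype.card_fin,
        integral_exp_neg_jump hr0 hb hba ha1 ht0.le, mul_div_cancel₀ _ hr0.ne',
        mul_div_cancel₀ _ hr0.ne']
    have hlαt : Real.log (α + t) - Real.log (β + t) ≤ K := by
      rw [hK, Real.log_div (by positivity) (by positivity)]
      have h1 : Real.log (α + t) ≤ Real.log (α + 2) := Real.log_le_log (by positivity) (by linarith)
      have h2 : Real.log β ≤ Real.log (β + t) := Real.log_le_log hβ0 (by linarith)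
      linarith
    have hψ0 : 0 ≤ ψ := by
      have : Real.log (β + t) ≤ Real.log (α + t) := Real.log_le_log (by positivity) (by linarith)
      exact mul_nonneg ht0.le (by linarith)
    have hψK : ψ ≤ t * K := mul_le_mul_of_nonneg_left hlαt ht0.le
    have hψ2 : ψ ≤ 2 * K := hψK.trans (by nlinarith)
    have hψr : ψ / r ≤ 1 / 2 := by
      rw [div_le_iff₀ hr0]; linarith
    obtain ⟨hlo, hhi⟩ := mul_log_one_sub_bounds hr0 hψ0 hψr
    have herr : 2 * ψ ^ 2 / r ≤ τ * t := by
      rw [div_le_iff₀ hr0]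
      rw [div_le_iff₀ hτ] at hrK
      have : ψ ^ 2 ≤ t * K * (2 * K) := by
        rw [sq]
        exact mul_le_mul hψK hψ2 hψ0 (by positivity)
      nlinarith
    -- The cutoffs are tuned to the range of `t`: `t / α ≤ τ` because `t ≤ 2`, and below `β / t ≤ τ`
    -- because `1 / N ≤ t`.
    have hlogα : Real.log (α + t) - Real.log α ≤ τ := by
      rw [← Real.log_div (by positivity) (by positivity)]
      refine (Real.log_le_sub_one_of_pos (by positivity)).trans ?_
      rw [sub_le_iff_le_add, div_le_iff₀ hα0]
      have : τ * α = 2 := by rw [hα]; field_simp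
      nlinarith
    have hlogt : Real.log (β + t) - Real.log t ≤ τ := by
      rw [← Real.log_div (by positivity) (by positivity)]
      refine (Real.log_le_sub_one_of_pos (by positivity)).trans ?_
      rw [sub_le_iff_le_add, div_le_iff₀ ht0]
      have : β ≤ τ * t := by
        rw [hβ, div_eq_mul_one_div]
        exact mul_le_mul_of_nonneg_left ht1 hτ.le
      linarith
    have hlogα0 : Real.log α ≤ Real.log (α + t) := Real.log_le_log hα0 (by linarith)
    have hlogt0 : Real.log t ≤ Real.log (β + t) := Real.log_le_log ht0 (by linarith)
    rw [hφ]
    refine ⟨pow_pos (by linarith) r, ?_⟩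
    have hup : ψ ≤ t * (Real.log α - Real.log t + τ) :=
      mul_le_mul_of_nonneg_left (by linarith) ht0.le
    have hdn : t * (Real.log α - Real.log t - τ) ≤ ψ :=
      mul_le_mul_of_nonneg_left (by linarith) ht0.le
    rw [Real.log_pow, abs_le]
    constructor <;> linarith

/-! ### Moments and tails of the sketches -/

section Sketch

variable {Ω : Type} [MeasurableSpace Ω] {μ : Measure Ω} [IsProbabilityMeasure μ] {Z : Ω → ℝ}
  {N τ α : ℝ} {n : ℕ}

theorem integral_exp_neg_sum (t : Fin n → ℝ) :
    ∫ ω, Real.exp (-∑ j, t j * Z (ω j)) ∂(Measure.pi fun _ : Fin n => μ) =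
      ∏ j, ∫ ω, Real.exp (-(t j * Z ω)) ∂μ := by
  rw [← integral_fintype_prod_eq_prod (𝕜 := ℝ) (fun j ω => Real.exp (-(t j * Z ω)))]
  congr 1
  funext ω
  rw [← Real.exp_sum, Finset.sum_neg_distrib]

theorem abs_log_integral_exp_neg_sum_le
    (hφ : ∀ t, 1 / N ≤ t → t ≤ 2 → 0 < ∫ ω, Real.exp (-(t * Z ω)) ∂μ ∧
        |Real.log (∫ ω, Real.exp (-(t * Z ω)) ∂μ) - (t * Real.log t - t * Real.log α)| ≤
          2 * τ * t) (t : Fin n → ℝ) (ht : ∀ j, t j = 0 ∨ 1 / N ≤ t j ∧ t j ≤ 2) :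
    0 < ∫ ω, Real.exp (-∑ j, t j * Z (ω j)) ∂(Measure.pi fun _ : Fin n => μ) ∧
      |Real.log (∫ ω, Real.exp (-∑ j, t j * Z (ω j)) ∂(Measure.pi fun _ : Fin n => μ)) -
        ∑ j, (t j * Real.log (t j) - t j * Real.log α)| ≤ 2 * τ * ∑ j, t j := by
  have h : ∀ j, 0 < ∫ ω, Real.exp (-(t j * Z ω)) ∂μ ∧
      |Real.log (∫ ω, Real.exp (-(t j * Z ω)) ∂μ) - (t j * Real.log (t j) - t j * Real.log α)| ≤
          2 * τ * t j := by
    intro j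
    rcases ht j with h | ⟨h1, h2⟩
    · simp [h]
    · exact hφ _ h1 h2
  rw [integral_exp_neg_sum]
  refine ⟨Finset.prod_pos fun j _ => (h j).1, ?_⟩
  rw [Real.log_prod (fun j _ => (h j).1.ne'), ← Finset.sum_sub_distrib, Finset.mul_sum]
  exact (Finset.abs_sum_le_sum_abs _ _).trans (Finset.sum_le_sum fun j _ => (h j).2)

/-- The mean of one sketch, `exp (-∑ⱼ pⱼ Zⱼ)`. -/
def sketchMean (μ : Measure Ω) (Z : Ω → ℝ) (p : Fin n → ℝ) : ℝ :=
  ∫ ω, Real.exp (-∑ j, p j * Z (ω j)) ∂(Measure.pi fun _ : Fin n => μ)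

/-- The logarithms of the transforms add up, and `∑ j, p j = 1` makes the linear terms the constant
`-log α`. -/
theorem sketchMean_bounds
    (hφ : ∀ t, 1 / N ≤ t → t ≤ 2 → 0 < ∫ ω, Real.exp (-(t * Z ω)) ∂μ ∧
        |Real.log (∫ ω, Real.exp (-(t * Z ω)) ∂μ) - (t * Real.log t - t * Real.log α)| ≤
          2 * τ * t) {p : Fin n → ℝ} (hp : ∀ j, p j = 0 ∨ 1 / N ≤ p j ∧ p j ≤ 1)
    (hp1 : ∑ j, p j = 1) :
    0 < sketchMean μ Z p ∧
      |Real.log (sketchMean μ Z p) - (∑ j, p j * Real.log (p j) - Real.log α)| ≤ 2 * τ := by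
  have h := abs_log_integral_exp_neg_sum_le hφ p fun j =>
    (hp j).imp_right fun h => ⟨h.1, by linarith [h.2]⟩
  rw [Finset.sum_sub_distrib, ← Finset.sum_mul, hp1, one_mul, mul_one] at h
  exact h

/-- The square of the sketch is the sketch at `2 * p`, which is why the transform is controlled up
to `t = 2`. The ideal ratio to the squared mean is `4`; the approximation errors add at most `8 * τ
≤ 1 / 5 ≤ log (5 / 4)` to its logarithm. -/
theorem integral_exp_neg_sum_sq_le
    (hφ : ∀ t, 1 / N ≤ t → t ≤ 2 → 0 < ∫ ω, Real.exp (-(t * Z ω)) ∂μ ∧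
        |Real.log (∫ ω, Real.exp (-(t * Z ω)) ∂μ) - (t * Real.log t - t * Real.log α)| ≤
          2 * τ * t) (hN : 0 < N) (hτ1 : τ ≤ 1 / 40) {p : Fin n → ℝ}
    (hp : ∀ j, p j = 0 ∨ 1 / N ≤ p j ∧ p j ≤ 1) (hp1 : ∑ j, p j = 1) :
    ∫ ω, Real.exp (-∑ j, p j * Z (ω j)) ^ 2 ∂(Measure.pi fun _ : Fin n => μ) ≤
      5 * sketchMean μ Z p ^ 2 := by
  obtain ⟨h0, h1⟩ := sketchMean_bounds hφ hp hp1
  obtain ⟨h2, h3⟩ := abs_log_integral_exp_neg_sum_le hφ (fun j => 2 * p j) fun j => by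
    rcases hp j with h | h
    · left; simp [h]
    · right
      have : 0 < 1 / N := by positivity
      constructor <;> linarith [h.1, h.2]
  have h4 : ∀ ω : Fin n → Ω, Real.exp (-∑ j, p j * Z (ω j)) ^ 2 =
      Real.exp (-∑ j, 2 * p j * Z (ω j)) := by
    intro ω
    rw [← Real.exp_nat_mul]
    congr 1
    push_cast
    rw [mul_neg, Finset.mul_sum]
    congr 1
    exact Finset.sum_congr rfl fun j _ => by ring
  simp_rw [h4]
  have h5 : ∑ j, (2 * p j * Real.log (2 * p j) - 2 * p j * Real.log α) =
      2 * Real.log 2 + 2 * (∑ j, p j * Real.log (p j) - Real.log α) := by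
    have : ∀ j, 2 * p j * Real.log (2 * p j) - 2 * p j * Real.log α =
        2 * Real.log 2 * p j + 2 * (p j * Real.log (p j)) - 2 * Real.log α * p j := by
      intro j
      rcases eq_or_ne (p j) 0 with h | h
      · simp [h]
      · rw [Real.log_mul two_ne_zero h]; ring
    simp_rw [this]
    rw [Finset.sum_sub_distrib, Finset.sum_add_distrib, ← Finset.mul_sum, ← Finset.mul_sum,
      ← Finset.mul_sum, hp1]
    ring
  rw [h5, ← Finset.mul_sum, hp1] at h3
  rw [← Real.log_le_log_iff h2 (by positivity), Real.log_mul (by norm_num) (by positivity),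
    Real.log_pow]
  have h6 : 1 / 5 ≤ Real.log 5 - 2 * Real.log 2 := by
    have : Real.log 5 - 2 * Real.log 2 = Real.log (5 / 4) := by
      rw [Real.log_div (by norm_num) (by norm_num), show (4:ℝ) = 2 ^ 2 by norm_num, Real.log_pow]
      push_cast; ring
    rw [this]
    have := Real.one_sub_inv_le_log_of_pos (show (0:ℝ) < 5 / 4 by norm_num)
    norm_num at this ⊢
    linarith
  have h7 := (abs_le.1 h1).1
  have h8 := (abs_le.1 h3).2
  push_cast
  linarith

/-- By Chebyshev's inequality an average of independent sketches is close to its mean. -/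
theorem measureReal_average_le (hZm : Measurable Z) (hZ0 : ∀ ω, 0 ≤ Z ω)
    (hφ : ∀ t, 1 / N ≤ t → t ≤ 2 → 0 < ∫ ω, Real.exp (-(t * Z ω)) ∂μ ∧
        |Real.log (∫ ω, Real.exp (-(t * Z ω)) ∂μ) - (t * Real.log t - t * Real.log α)| ≤
          2 * τ * t) (hN : 0 < N) (hτ : 0 < τ) (hτ1 : τ ≤ 1 / 40) {p : Fin n → ℝ}
    (hp : ∀ j, p j = 0 ∨ 1 / N ≤ p j ∧ p j ≤ 1) (hp1 : ∑ j, p j = 1) {k : ℕ}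
    (hk : 100 / τ ^ 2 ≤ k) :
    (Measure.pi fun _ : Fin k => Measure.pi fun _ : Fin n => μ).real
      {ω | τ * sketchMean μ Z p ≤
        |(∑ q, Real.exp (-∑ j, p j * Z (ω q j))) / k - sketchMean μ Z p|} ≤ 1 / 20 := by
  obtain ⟨hm0, -⟩ := sketchMean_bounds hφ hp hp1
  have hk0 : (0 : ℝ) < k := lt_of_lt_of_le (by positivity) hk
  have hp0 : ∀ j, 0 ≤ p j := by
    intro j
    have : 0 < 1 / N := by positivity
    rcases hp j with h | h <;> linarith [h]
  set f : (Fin n → Ω) → ℝ := fun ω => Real.exp (-∑ j, p j * Z (ω j)) with hf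
  have hfm : Measurable f := by
    refine Real.measurable_exp.comp (Finset.measurable_fun_sum _ fun j _ => ?_).neg
    exact (hZm.comp (measurable_pi_apply j)).const_mul _
  have hfL : MemLp f 2 (Measure.pi fun _ : Fin n => μ) := by
    refine MemLp.of_bound hfm.aestronglyMeasurable 1 (ae_of_all _ fun ω => ?_)
    rw [Real.norm_of_nonneg (Real.exp_pos _).le, Real.exp_le_one_iff, neg_nonpos]
    exact Finset.sum_nonneg fun j _ => mul_nonneg (hp0 j) (hZ0 _)
  have hvar : Var[f; Measure.pi fun _ : Fin n => μ] ≤ 5 * sketchMean μ Z p ^ 2 := by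
    refine (variance_le_expectation_sq hfL.aestronglyMeasurable).trans ?_
    exact integral_exp_neg_sum_sq_le hφ hN hτ1 hp hp1
  have hL : ∀ q : Fin k, MemLp (fun ω : Fin k → Fin n → Ω => f (ω q)) 2
      (Measure.pi fun _ : Fin k => Measure.pi fun _ : Fin n => μ) := fun q =>
    hfL.comp_measurePreserving (measurePreserving_eval _ q)
  set g : (Fin k → Fin n → Ω) → ℝ := ∑ q, fun ω => f (ω q) with hg
  have hgv : Var[g; Measure.pi fun _ : Fin k => Measure.pi fun _ : Fin n => μ] =
      k * Var[f; Measure.pi fun _ : Fin n => μ] := by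
    rw [hg, variance_sum_pi (X := fun _ : Fin k => f) fun _ => hfL]
    simp
  have hgL : MemLp g 2 (Measure.pi fun _ : Fin k => Measure.pi fun _ : Fin n => μ) :=
    memLp_finsetSum' _ fun q _ => hL q
  have hgE : ∫ ω, g ω ∂(Measure.pi fun _ : Fin k => Measure.pi fun _ : Fin n => μ) =
      k * sketchMean μ Z p := by
    simp only [hg, Finset.sum_apply]
    rw [integral_finsetSum _ fun q _ => (hL q).integrable (by norm_num)]
    have : ∀ q : Fin k, ∫ ω : Fin k → Fin n → Ω, f (ω q)
        ∂(Measure.pi fun _ : Fin k => Measure.pi fun _ : Fin n => μ) = sketchMean μ Z p := fun q =>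
      integral_comp_eval (μ := fun _ : Fin k => Measure.pi fun _ : Fin n => μ)
        hfm.aestronglyMeasurable
    simp [this]
  -- The resulting bound is `5 / (k * τ ^ 2)`, at most `1 / 20` by the choice of `k`.
  have h := meas_ge_le_variance_div_sq hgL (mul_pos hk0 (mul_pos hτ hm0))
  rw [hgE, hgv] at h
  have hset : {ω : Fin k → Fin n → Ω | τ * sketchMean μ Z p ≤
        |(∑ q, Real.exp (-∑ j, p j * Z (ω q j))) / k - sketchMean μ Z p|} =
      {ω | k * (τ * sketchMean μ Z p) ≤ |g ω - k * sketchMean μ Z p|} := by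
    ext ω
    have h1 : g ω - k * sketchMean μ Z p =
        k * ((∑ q, Real.exp (-∑ j, p j * Z (ω q j))) / k - sketchMean μ Z p) := by
      simp only [hg, Finset.sum_apply, hf]
      field_simp
    rw [Set.mem_ofPred_eq, Set.mem_ofPred_eq, h1, abs_mul, abs_of_pos hk0,
      mul_le_mul_iff_right₀ hk0]
  rw [hset]
  refine ENNReal.toReal_le_of_le_ofReal (by norm_num) (h.trans (ENNReal.ofReal_le_ofReal ?_))
  rw [div_le_iff₀ (by positivity)]
  rw [div_le_iff₀ (by positivity)] at hk
  have h1 : k * Var[f; Measure.pi fun _ : Fin n => μ] ≤ k * (5 * sketchMean μ Z p ^ 2) :=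
    mul_le_mul_of_nonneg_left hvar hk0.le
  have h2 : 100 * (k * sketchMean μ Z p ^ 2) ≤ (k * τ ^ 2) * (k * sketchMean μ Z p ^ 2) :=
    mul_le_mul_of_nonneg_right hk (by positivity)
  nlinarith

/-- By Markov's inequality no discretized linear sketch is large. -/
theorem measureReal_exists_floor_gt_le (hZm : Measurable Z) (hZ0 : ∀ ω, 0 ≤ Z ω)
    (hZi : Integrable Z μ) (hτ : 0 < τ) {x : Fin n → ℝ} (hx : ∀ j, 0 ≤ x j) (hxN : ∑ j, x j ≤ N)
    {k : ℕ} {T : ℝ} (hT : 0 < T) (hkT : 40 * (k * (N * ∫ ω, Z ω / τ ∂μ)) ≤ T) :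
    (Measure.pi fun _ : Fin k => Measure.pi fun _ : Fin n => μ).real
      {ω | ∃ q, T ≤ ∑ j, x j * ⌊Z (ω q j) / τ⌋₊} ≤ 1 / 40 := by
  set g : (Fin n → Ω) → ℝ := fun ω => ∑ j, x j * (Z (ω j) / τ) with hg
  have hi1 : ∀ j, Integrable (fun ω : Fin n → Ω => x j * (Z (ω j) / τ))
      (Measure.pi fun _ : Fin n => μ) := fun j =>
    ((integrable_comp_eval (μ := fun _ : Fin n => μ) (i := j) hZi).div_const τ).const_mul _
  have hgi : Integrable g (Measure.pi fun _ : Fin n => μ) := integrable_finsetSum _ fun j _ => hi1 j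
  have hg0 : ∀ ω, 0 ≤ g ω := fun ω => Finset.sum_nonneg fun j _ =>
    mul_nonneg (hx j) (div_nonneg (hZ0 _) hτ.le)
  have hgE : ∫ ω, g ω ∂(Measure.pi fun _ : Fin n => μ) ≤ N * ∫ ω, Z ω / τ ∂μ := by
    simp only [hg]
    rw [integral_finsetSum _ fun j _ => hi1 j]
    have : ∀ j, ∫ ω : Fin n → Ω, x j * (Z (ω j) / τ) ∂(Measure.pi fun _ : Fin n => μ) =
        x j * ∫ ω, Z ω / τ ∂μ := by
      intro j
      rw [integral_const_mul, integral_comp_eval (μ := fun _ : Fin n => μ) (i := j)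
        (f := fun ω => Z ω / τ) (hZm.div_const τ).aestronglyMeasurable]
    simp_rw [this]
    rw [← Finset.sum_mul]
    exact mul_le_mul_of_nonneg_right hxN (integral_nonneg fun ω => div_nonneg (hZ0 ω) hτ.le)
  have hsub : {ω : Fin k → Fin n → Ω | ∃ q, T ≤ ∑ j, x j * ⌊Z (ω q j) / τ⌋₊} ⊆
      ⋃ q ∈ (Finset.univ : Finset (Fin k)), {ω | T ≤ g (ω q)} := by
    rintro ω ⟨q, hq⟩
    simp only [Finset.mem_univ, Set.iUnion_true, Set.mem_iUnion]
    refine ⟨q, hq.trans (Finset.sum_le_sum fun j _ => ?_)⟩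
    exact mul_le_mul_of_nonneg_left (Nat.floor_le (div_nonneg (hZ0 _) hτ.le)) (hx j)
  refine (measureReal_mono hsub (measure_ne_top _ _)).trans ((measureReal_biUnion_finset_le _ _).trans ?_)
  have h1 : ∀ q : Fin k, (Measure.pi fun _ : Fin k => Measure.pi fun _ : Fin n => μ).real
      {ω | T ≤ g (ω q)} ≤ (N * ∫ ω, Z ω / τ ∂μ) / T := by
    intro q
    have h := mul_meas_ge_le_integral_of_nonneg
      (μ := Measure.pi fun _ : Fin k => Measure.pi fun _ : Fin n => μ)
      (f := fun ω => g (ω q)) (ae_of_all _ fun ω => hg0 _)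
      (integrable_comp_eval (μ := fun _ : Fin k => Measure.pi fun _ : Fin n => μ) (i := q) hgi) T
    rw [integral_comp_eval (μ := fun _ : Fin k => Measure.pi fun _ : Fin n => μ) (i := q)
      hgi.aestronglyMeasurable] at h
    rw [le_div_iff₀ hT, mul_comm]
    exact h.trans hgE
  refine (Finset.sum_le_sum fun q _ => h1 q).trans ?_
  rw [Finset.sum_const, nsmul_eq_mul, Finset.card_univ, Fintype.card_fin, ← mul_div_assoc,
    div_le_iff₀ hT]
  linarith

end Sketch

/-! ### Error propagation from the registers to the entropy -/

section Deterministic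

/-- A relative error in the exponent is harmless while `s ≤ L`, where it costs at most `τ`. Beyond
`L` both exponentials are at most `exp (2 * τ) * exp (-L)`, since then `s' ≥ L - 2 * τ`. The
additive `exp (-L)` is later compared with the mean of the sketch. -/
theorem exp_neg_le_of_close {s s' τ η L : ℝ} (hτ : 0 ≤ τ) (hη : 0 ≤ η)
    (hηL : 3 * η * L ≤ τ) (hη1 : 3 * η ≤ 1) (h1 : s' ≤ (1 + 3 * η) * s)
    (h2 : (1 - 3 * η) * (s - τ) ≤ s') :
    Real.exp (-s') ≤ Real.exp (2 * τ) * (Real.exp (-s) + Real.exp (-L)) ∧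
      Real.exp (-s) ≤ Real.exp τ * (Real.exp (-s') + Real.exp (-L)) := by
  have e1 := Real.exp_pos (-s)
  have e2 := Real.exp_pos (-L)
  have e3 := Real.exp_pos (-s')
  rcases le_total s L with h | h
  · have hs : 3 * η * s ≤ τ := by nlinarith
    constructor
    · have : Real.exp (-s') ≤ Real.exp (2 * τ) * Real.exp (-s) := by
        rw [← Real.exp_add, Real.exp_le_exp]
        nlinarith
      refine this.trans (mul_le_mul_of_nonneg_left (by linarith) (Real.exp_pos _).le)
    · have : Real.exp (-s) ≤ Real.exp τ * Real.exp (-s') := by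
        rw [← Real.exp_add, Real.exp_le_exp]
        nlinarith
      refine this.trans (mul_le_mul_of_nonneg_left (by linarith) (Real.exp_pos _).le)
  · constructor
    · have : Real.exp (-s') ≤ Real.exp (2 * τ) * Real.exp (-L) := by
        rw [← Real.exp_add, Real.exp_le_exp]
        have : (1 - 3 * η) * (L - τ) ≤ (1 - 3 * η) * (s - τ) :=
          mul_le_mul_of_nonneg_left (by linarith) (by linarith)
        nlinarith
      refine this.trans (mul_le_mul_of_nonneg_left (by linarith) (Real.exp_pos _).le)
    · have h3 : Real.exp (-s) ≤ Real.exp (-L) := Real.exp_le_exp.2 (by linarith)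
      have h4 : 1 ≤ Real.exp τ := Real.one_le_exp hτ
      nlinarith

theorem abs_log_sub_le_of_close {A A' m τ l : ℝ} (hτ : 0 < τ) (hτ1 : τ ≤ 1 / 40) (hm : 0 < m)
    (hl : l ≤ τ * m) (hA : |A - m| ≤ τ * m) (h1 : A' ≤ Real.exp (2 * τ) * (A + l))
    (h2 : A ≤ Real.exp τ * (A' + l)) : |Real.log A' - Real.log m| ≤ 6 * τ := by
  obtain ⟨h3, h4⟩ := abs_le.1 hA
  have e1 : Real.exp (-τ) * Real.exp τ = 1 := by rw [← Real.exp_add]; simp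
  have e0 := Real.exp_pos (-τ)
  have h5 : (1 - 3 * τ) * m ≤ A' := by
    have h6 : Real.exp (-τ) * A ≤ A' + l := by
      calc Real.exp (-τ) * A ≤ Real.exp (-τ) * (Real.exp τ * (A' + l)) :=
            mul_le_mul_of_nonneg_left h2 e0.le
        _ = A' + l := by rw [← mul_assoc, e1, one_mul]
    have h7 : 1 - τ ≤ Real.exp (-τ) := by linarith [Real.add_one_le_exp (-τ)]
    have h8 : (1 - τ) * ((1 - τ) * m) ≤ Real.exp (-τ) * A :=
      mul_le_mul h7 (by linarith) (mul_nonneg (by linarith) hm.le) e0.le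
    nlinarith
  have hA'0 : 0 < A' := lt_of_lt_of_le (mul_pos (by linarith) hm) h5
  rw [abs_le]
  constructor
  · have h6 : Real.log ((1 - 3 * τ) * m) ≤ Real.log A' :=
      Real.log_le_log (mul_pos (by linarith) hm) h5
    rw [Real.log_mul (by linarith) hm.ne'] at h6
    have h7 := Real.one_sub_inv_le_log_of_pos (show 0 < 1 - 3 * τ by linarith)
    have h8 : (1 - 3 * τ)⁻¹ ≤ 1 + 6 * τ := by
      rw [inv_le_iff_one_le_mul₀ (by linarith)]
      nlinarith
    linarith
  · have h6 : A' ≤ Real.exp (4 * τ) * m := by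
      have h7 : A + l ≤ Real.exp (2 * τ) * m := by
        have := Real.add_one_le_exp (2 * τ)
        nlinarith
      calc A' ≤ _ := h1
        _ ≤ Real.exp (2 * τ) * (Real.exp (2 * τ) * m) :=
          mul_le_mul_of_nonneg_left h7 (Real.exp_pos _).le
        _ = _ := by rw [← mul_assoc, ← Real.exp_add]; ring_nf
    have h7 := Real.log_le_log hA'0 h6
    rw [Real.log_mul (Real.exp_pos _).ne' hm.ne', Real.log_exp] at h7
    linarith

/-- The quotient of two approximate sums approximates the quotient of the sums. -/
theorem quotient_close {W S T V V' τ η : ℝ} (hτ : 0 < τ) (hη : 0 ≤ η) (hη1 : 3 * η ≤ 1)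
    (hW : 0 < W) (hT0 : 0 ≤ T) (hT1 : τ * T ≤ W * S) (hT2 : W * (S - τ) ≤ τ * T)
    (hV : |V - T| ≤ η * T) (hV' : |V' - W| ≤ η * W) :
    τ * V / V' ≤ (1 + 3 * η) * S ∧ (1 - 3 * η) * (S - τ) ≤ τ * V / V' := by
  obtain ⟨h1, h2⟩ := abs_le.1 hV
  obtain ⟨h3, h4⟩ := abs_le.1 hV'
  have hV'0 : 0 < V' := by nlinarith
  have hS : 0 ≤ S := by
    by_contra h
    nlinarith [mul_nonneg hτ.le hT0, mul_pos hW (neg_pos.2 (not_le.1 h))]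
  constructor
  · rw [div_le_iff₀ hV'0]
    have a1 : τ * V ≤ (1 + η) * (W * S) := by nlinarith
    have a2 : (1 - η) * W ≤ V' := by linarith
    have a3 : (1 + 3 * η) * S * ((1 - η) * W) ≤ (1 + 3 * η) * S * V' :=
      mul_le_mul_of_nonneg_left a2 (by positivity)
    -- This is the slack in `(1 + 3 * η) * (1 - η) ≥ 1 + η`.
    have a4 : 0 ≤ W * S * (η * (1 - 3 * η)) :=
      mul_nonneg (mul_nonneg hW.le hS) (mul_nonneg hη (by linarith))
    nlinarith
  · rw [le_div_iff₀ hV'0]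
    have a0 : (1 - η) * (τ * T) ≤ τ * V := by nlinarith
    rcases le_total S τ with h | h
    · have b1 : (1 - 3 * η) * (S - τ) * V' ≤ 0 :=
        mul_nonpos_of_nonpos_of_nonneg
          (mul_nonpos_of_nonneg_of_nonpos (by linarith) (by linarith)) hV'0.le
      have b2 : 0 ≤ (1 - η) * (τ * T) := mul_nonneg (by linarith) (by positivity)
      linarith
    · have a1 : (1 - η) * (W * (S - τ)) ≤ (1 - η) * (τ * T) :=
        mul_le_mul_of_nonneg_left hT2 (by linarith)
      have a2 : (1 - 3 * η) * (S - τ) * V' ≤ (1 - 3 * η) * (S - τ) * ((1 + η) * W) :=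
        mul_le_mul_of_nonneg_left (by linarith) (mul_nonneg (by linarith) (by linarith))
      have a3 : 0 ≤ W * (S - τ) * (η + 3 * η ^ 2) :=
        mul_nonneg (mul_nonneg hW.le (by linarith)) (by positivity)
      nlinarith

end Deterministic

/-- The output computed from the rounded registers: `none` holds the `ℓ¹`-norm and `some q` the
`q`-th linear sketch, in units of `τ`. -/
def entropyEstimate (k : ℕ) (τ : ℝ) (V : Option (Fin k) → ℝ) : ℝ :=
  -Real.log ((∑ q, Real.exp (-(τ * V (some q) / V none))) / k) - Real.log (2 / τ)

theorem shannonEntropy_eq {n : ℕ} {x : Fin n → ℝ} (hx : ∀ j, 0 ≤ x j) :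
    shannonEntropy x = -∑ j, (x j / ∑ i, x i) * Real.log (x j / ∑ i, x i) := by
  have h : ∑ i, |x i| = ∑ i, x i := Finset.sum_congr rfl fun j _ => abs_of_nonneg (hx j)
  rw [shannonEntropy, h, ← Finset.sum_neg_distrib]
  refine Finset.sum_congr rfl fun j _ => ?_
  rw [abs_of_nonneg (hx j), ← inv_div (x j), Real.log_inv]
  ring

theorem weights_of_nat {n : ℕ} {N : ℝ} {x : Fin n → ℝ} (hx : ∀ j, x j = 0 ∨ 1 ≤ x j)
    (hW : 0 < ∑ i, x i) (hWN : ∑ i, x i ≤ N) :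
    (∀ j, x j / ∑ i, x i = 0 ∨ 1 / N ≤ x j / ∑ i, x i ∧ x j / ∑ i, x i ≤ 1) ∧
      ∑ j, x j / ∑ i, x i = 1 := by
  constructor
  · intro j
    rcases hx j with h | h
    · simp [h]
    · right
      constructor
      · gcongr
      · rw [div_le_one hW]
        refine Finset.single_le_sum (f := x) (fun j _ => ?_) (Finset.mem_univ j)
        rcases hx j with h | h <;> linarith
  · rw [← Finset.sum_div, div_self hW.ne']

/-- Discretization, rounding and averaging move the logarithm of the average by at most `6 * τ` from
`log m`, and `log m` is within `2 * τ` of its ideal value. -/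
theorem abs_entropyEstimate_sub_le {n k : ℕ} {N τ η L m : ℝ} (hN : 0 < N) (hτ : 0 < τ)
    (hτ1 : τ ≤ 1 / 40) (hη : 0 < η) (hL : Real.log N + Real.log (2 / τ) + 1 + Real.log (1 / τ) ≤ L)
    (hL1 : 1 ≤ L) (hηL : 3 * η * L ≤ τ) {x : Fin n → ℝ} (hx : ∀ j, x j = 0 ∨ 1 ≤ x j)
    (hW : 0 < ∑ i, x i) (hWN : ∑ i, x i ≤ N) (hk : 0 < k) (hm : 0 < m)
    (hlm : |Real.log m - (∑ j, (x j / ∑ i, x i) * Real.log (x j / ∑ i, x i) - Real.log (2 / τ))| ≤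
      2 * τ) {z : Fin k → Fin n → ℝ} (hz : ∀ q j, 0 ≤ z q j)
    (hA : |(∑ q, Real.exp (-∑ j, (x j / ∑ i, x i) * z q j)) / k - m| ≤ τ * m)
    {V : Option (Fin k) → ℝ}
    (hV : ∀ q, |V (some q) - ∑ j, x j * ⌊z q j / τ⌋₊| ≤ η * ∑ j, x j * ⌊z q j / τ⌋₊)
    (hV' : |V none - ∑ j, x j| ≤ η * ∑ j, x j) :
    |entropyEstimate k τ V - shannonEntropy x| ≤ 8 * τ := by
  obtain ⟨hp, hp1⟩ := weights_of_nat hx hW hWN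
  set W := ∑ i, x i with hWd
  have hx0 : ∀ j, 0 ≤ x j := fun j => by rcases hx j with h | h <;> linarith
  have hk0 : (0 : ℝ) < k := Nat.cast_pos.2 hk
  have hη1 : 3 * η ≤ 1 := by nlinarith
  have hplog : -Real.log N ≤ ∑ j, (x j / W) * Real.log (x j / W) := by
    calc -Real.log N = ∑ j, (x j / W) * -Real.log N := by rw [← Finset.sum_mul, hp1, one_mul]
      _ ≤ _ := by
        refine Finset.sum_le_sum fun j _ => ?_
        rcases hp j with h | ⟨h, -⟩
        · simp [h]
        · have h0 : 0 < 1 / N := by positivity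
          refine mul_le_mul_of_nonneg_left ?_ (by linarith)
          have := Real.log_le_log h0 h
          rwa [one_div, Real.log_inv] at this
  -- The entropy is at most `log N`, so `m` is not much below `τ / (2 * N)`; `L` is chosen to make
  -- `exp (-L)` smaller by a further factor `τ`.
  have hl : Real.exp (-L) ≤ τ * m := by
    rw [← Real.le_log_iff_exp_le (by positivity), Real.log_mul hτ.ne' hm.ne']
    rw [one_div, Real.log_inv] at hL
    have := (abs_le.1 hlm).1
    linarith
  have hclose : ∀ q, Real.exp (-(τ * V (some q) / V none)) ≤
        Real.exp (2 * τ) * (Real.exp (-∑ j, (x j / W) * z q j) + Real.exp (-L)) ∧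
      Real.exp (-∑ j, (x j / W) * z q j) ≤
        Real.exp τ * (Real.exp (-(τ * V (some q) / V none)) + Real.exp (-L)) := by
    intro q
    have hS : W * ∑ j, (x j / W) * z q j = ∑ j, x j * z q j := by
      rw [Finset.mul_sum]
      refine Finset.sum_congr rfl fun j _ => ?_
      field_simp
    obtain ⟨h1, h2⟩ := quotient_close (S := ∑ j, (x j / W) * z q j) hτ hη.le hη1 hW
      (Finset.sum_nonneg fun j _ => mul_nonneg (hx0 j) (Nat.cast_nonneg _)) (by
        rw [hS, Finset.mul_sum]
        refine Finset.sum_le_sum fun j _ => ?_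
        have := Nat.floor_le (div_nonneg (hz q j) hτ.le)
        rw [le_div_iff₀ hτ] at this
        calc τ * (x j * ⌊z q j / τ⌋₊) = x j * (⌊z q j / τ⌋₊ * τ) := by ring
          _ ≤ _ := mul_le_mul_of_nonneg_left this (hx0 j)) (by
        rw [mul_sub, hS, hWd, Finset.sum_mul, ← Finset.sum_sub_distrib, Finset.mul_sum]
        refine Finset.sum_le_sum fun j _ => ?_
        have := Nat.lt_floor_add_one (z q j / τ)
        rw [div_lt_iff₀ hτ] at this
        calc x j * z q j - x j * τ = x j * (z q j - τ) := by ring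
          _ ≤ x j * (⌊z q j / τ⌋₊ * τ) := mul_le_mul_of_nonneg_left (by linarith) (hx0 j)
          _ = _ := by ring) (hV q) hV'
    exact exp_neg_le_of_close hτ.le hη.le hηL hη1 h1 h2
  have havg1 : (∑ q, Real.exp (-(τ * V (some q) / V none))) / k ≤
      Real.exp (2 * τ) * ((∑ q, Real.exp (-∑ j, (x j / W) * z q j)) / k + Real.exp (-L)) := by
    rw [div_le_iff₀ hk0]
    refine (Finset.sum_le_sum fun q _ => (hclose q).1).trans (le_of_eq ?_)
    rw [← Finset.mul_sum, Finset.sum_add_distrib]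
    simp only [Finset.sum_const, Finset.card_univ, Fintype.card_fin, nsmul_eq_mul]
    field_simp
  have havg2 : (∑ q, Real.exp (-∑ j, (x j / W) * z q j)) / k ≤
      Real.exp τ * ((∑ q, Real.exp (-(τ * V (some q) / V none))) / k + Real.exp (-L)) := by
    rw [div_le_iff₀ hk0]
    refine (Finset.sum_le_sum fun q _ => (hclose q).2).trans (le_of_eq ?_)
    rw [← Finset.mul_sum, Finset.sum_add_distrib]
    simp only [Finset.sum_const, Finset.card_univ, Fintype.card_fin, nsmul_eq_mul]
    field_simp
  have hfin := abs_log_sub_le_of_close hτ hτ1 hm hl hA havg1 havg2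
  rw [shannonEntropy_eq hx0, entropyEstimate]
  obtain ⟨a1, a2⟩ := abs_le.1 hfin
  obtain ⟨a3, a4⟩ := abs_le.1 hlm
  rw [abs_le]
  constructor <;> linarith

/-! ### Assembling the protocol -/

/-- Tuples of `b`-bit numbers can be encoded by bit strings of the appropriate length. -/
theorem exists_encoding (ι : Type) [Fintype ι] (b : ℕ) :
    ∃ (enc : (ι → Fin (2 ^ b)) → List Bool) (dec : List Bool → ι → Fin (2 ^ b)),
      (∀ a, dec (enc a) = a) ∧ ∀ a, (enc a).length = Fintype.card ι * b := by
  classical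
  have e : (ι → Fin (2 ^ b)) ≃ (Fin (Fintype.card ι * b) → Bool) := Fintype.equivOfCardEq (by
    simp [← pow_mul, mul_comm])
  have hinj : Function.Injective fun a => List.ofFn (e a) :=
    fun a a' h => e.injective (List.ofFn_injective h)
  have : Nonempty (ι → Fin (2 ^ b)) := ⟨fun _ => ⟨0, by positivity⟩⟩
  exact ⟨fun a => List.ofFn (e a), Function.invFun _, Function.leftInverse_invFun hinj, by simp⟩

theorem measureReal_exists_bad_rounding_le {V Q : Type} [Fintype V] [DecidableEq V] [Fintype Q]
    (S : RootedTree V) {g η R T : ℝ} (hg : 1 < g) (hη : 0 < η) (hR : 0 < R) {a : Q → V → ℝ}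
    (ha : ∀ q u, a q u = 0 ∨ 1 ≤ a q u) (haT : ∀ q, ∑ u, a q u ≤ T) :
    (Measure.pi fun _ : Q => RootedTree.thresholdLaw V).real
      {θ | ∃ q, η * (∑ u, a q u) < |S.val g (a q) S.root (θ q) - ∑ u, a q u| ∨
        ∃ u, R ≤ S.val g (a q) u (θ q)} ≤
      Fintype.card Q * ((g - 1) / η ^ 2 + Fintype.card V * T / R) := by
  have hsub : {θ : Q → V → ℝ | ∃ q, η * (∑ u, a q u) <
        |S.val g (a q) S.root (θ q) - ∑ u, a q u| ∨ ∃ u, R ≤ S.val g (a q) u (θ q)} ⊆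
      ⋃ q ∈ (Finset.univ : Finset Q), Function.eval q ⁻¹'
        ({θ | η * (∑ u, a q u) < |S.val g (a q) S.root θ - ∑ u, a q u|} ∪
          {θ | ∃ u, R ≤ S.val g (a q) u θ}) := by
    rintro θ ⟨q, hq⟩
    simp only [Finset.mem_univ, Set.iUnion_true, Set.mem_iUnion]
    exact ⟨q, hq⟩
  refine (measureReal_mono hsub (measure_ne_top _ _)).trans
    ((measureReal_biUnion_finset_le _ _).trans ?_)
  have h1 : ∀ q, (Measure.pi fun _ : Q => RootedTree.thresholdLaw V).real (Function.eval q ⁻¹'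
        ({θ | η * (∑ u, a q u) < |S.val g (a q) S.root θ - ∑ u, a q u|} ∪
          {θ | ∃ u, R ≤ S.val g (a q) u θ})) ≤
      (g - 1) / η ^ 2 + Fintype.card V * T / R := by
    intro q
    have hm : MeasurableSet ({θ | η * (∑ u, a q u) < |S.val g (a q) S.root θ - ∑ u, a q u|} ∪
          {θ | ∃ u, R ≤ S.val g (a q) u θ}) := by
      refine MeasurableSet.union ?_ ?_
      · exact measurableSet_lt measurable_const
          (continuous_abs.measurable.comp ((S.measurable_val _).sub_const _))
      · have : {θ | ∃ u, R ≤ S.val g (a q) u θ} = ⋃ u, {θ | R ≤ S.val g (a q) u θ} := by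
          ext θ; simp
        rw [this]
        exact MeasurableSet.iUnion fun u => measurableSet_le measurable_const (S.measurable_val u)
    rw [Measure.real, (measurePreserving_eval (fun _ : Q => RootedTree.thresholdLaw V) q).measure_preimage
      hm.nullMeasurableSet, ← Measure.real]
    refine (measureReal_union_le _ _).trans (add_le_add
      (S.measureReal_val_root_le hg (ha q) hη)
      ((S.measureReal_exists_val_ge_le hg (ha q) hR).trans ?_))
    have := haT q
    gcongr
  refine (Finset.sum_le_sum fun q _ => h1 q).trans (le_of_eq ?_)
  rw [Finset.sum_const, nsmul_eq_mul, Finset.card_univ]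

/-- Code `0` is reserved for the value `0` and `g ^ e` has code `e + 1`; hence the exponent `2 ^ b -
1`. -/
theorem code_lt_of_val_lt {g R : ℝ} {b c : ℕ} (hg : 1 < g) (hb : R ≤ g ^ (2 ^ b - 1))
    (hc : gridVal g c < R) : c < 2 ^ b := by
  have h2 : 0 < 2 ^ b := by positivity
  cases c with
  | zero => exact h2
  | succ e =>
    have h1 : g ^ e < g ^ (2 ^ b - 1) := lt_of_lt_of_le hc hb
    have := (pow_lt_pow_iff_right₀ hg).1 h1
    omega

/-- If in a uniform sample at most a tenth of the first components is bad, and for each good first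
component at most a tenth of the second components is bad, then most pairs are good. -/
theorem card_good_ge {A B : Type} [Fintype A] [Fintype B] [DecidableEq A] (bad : Set A)
    (bad' : A → Set B)
    (h1 : ((Nat.card {i // i ∈ bad} : ℕ) : ℝ) ≤ 1 / 10 * Fintype.card A)
    (h2 : ∀ i ∉ bad, ((Nat.card {l // l ∈ bad' i} : ℕ) : ℝ) ≤ 1 / 10 * Fintype.card B)
    (good : Finset (A × B)) (hgood : ∀ i l, i ∉ bad → l ∉ bad' i → (i, l) ∈ good) :
    3 / 4 * ((Fintype.card A : ℝ) * Fintype.card B) ≤ good.card := by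
  classical
  have h3 : ((goodᶜ.card : ℕ) : ℝ) ≤ 1 / 5 * (Fintype.card A * Fintype.card B) := by
    have h4 : goodᶜ ⊆ ((Finset.univ.filter (· ∈ bad)) ×ˢ Finset.univ) ∪
        (Finset.univ.filter (· ∉ bad)).biUnion fun i =>
          ({i} : Finset A) ×ˢ Finset.univ.filter (· ∈ bad' i) := by
      rintro ⟨i, l⟩ hil
      by_cases hi : i ∈ bad
      · exact Finset.mem_union_left _ (by simp [hi])
      · refine Finset.mem_union_right _ ?_
        by_cases hl : l ∈ bad' i
        · simp [hi, hl]
        · exact absurd (hgood i l hi hl) (Finset.mem_compl.1 hil)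
    have h5 := (Finset.card_le_card h4).trans ((Finset.card_union_le _ _).trans
      (Nat.add_le_add_left Finset.card_biUnion_le _))
    have h6 : ((goodᶜ.card : ℕ) : ℝ) ≤ (Finset.univ.filter (· ∈ bad)).card * Fintype.card B +
        ∑ i ∈ Finset.univ.filter (· ∉ bad), ((Finset.univ.filter (· ∈ bad' i)).card : ℝ) := by
      simp only [Finset.card_product, Finset.card_singleton, one_mul, Finset.card_univ] at h5
      exact_mod_cast h5
    rw [Nat.card_eq_fintype_card, Fintype.card_subtype] at h1
    have h7 : ∑ i ∈ Finset.univ.filter (· ∉ bad), ((Finset.univ.filter (· ∈ bad' i)).card : ℝ) ≤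
        Fintype.card A * (1 / 10 * Fintype.card B) := by
      refine (Finset.sum_le_card_nsmul _ _ (1 / 10 * Fintype.card B : ℝ) fun i hi => ?_).trans ?_
      · have := h2 i (Finset.mem_filter.1 hi).2
        rwa [Nat.card_eq_fintype_card, Fintype.card_subtype] at this
      · rw [nsmul_eq_mul]
        refine mul_le_mul_of_nonneg_right ?_ (by positivity)
        exact_mod_cast Finset.card_le_univ _
    have h8 := mul_le_mul_of_nonneg_right h1 (Nat.cast_nonneg (α := ℝ) (Fintype.card B))
    linarith
  have h9 : ((goodᶜ.card : ℕ) : ℝ) + good.card = Fintype.card A * Fintype.card B := by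
    have := Finset.card_compl_add_card good
    rw [Fintype.card_prod] at this
    exact_mod_cast this
  have : (0 : ℝ) ≤ (Fintype.card A : ℝ) * Fintype.card B := by positivity
  linarith

/-- The multipliers of the registers: `none` counts, `some q` is the `q`-th discretized sketch. -/
def multiplier {k n : ℕ} (τ : ℝ) (z : Fin k → Fin n → ℝ) : Option (Fin k) → Fin n → ℕ
  | none, _ => 1
  | some q, j => ⌊z q j / τ⌋₊

/-- The contribution of a player with input `x` to a register. -/
def contribution {k n M : ℕ} (τ : ℝ) (z : Fin k → Fin n → ℝ) (q : Option (Fin k))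
    (x : Fin n → Fin (M + 1)) : ℝ :=
  ((∑ j, (x j : ℕ) * multiplier τ z q j : ℕ) : ℝ)

/-- Integer multipliers are what the rounding requires, since the smallest positive grid value is `g
^ 0 = 1`; this is the reason for discretizing the sketches. -/
theorem contribution_eq_zero_or {k n M : ℕ} (τ : ℝ) (z : Fin k → Fin n → ℝ) (q : Option (Fin k))
    (x : Fin n → Fin (M + 1)) : contribution τ z q x = 0 ∨ 1 ≤ contribution τ z q x := by
  rcases Nat.eq_zero_or_pos (∑ j, (x j : ℕ) * multiplier τ z q j) with h | h
  · left
    rw [contribution, h, Nat.cast_zero]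
  · right
    rw [contribution]
    exact_mod_cast h

theorem sum_contribution {k n m M : ℕ} (τ : ℝ) (z : Fin k → Fin n → ℝ) (q : Option (Fin k))
    (X : Fin m → Fin n → Fin (M + 1)) :
    ∑ u, contribution τ z q (X u) = ∑ j, aggregate X j * multiplier τ z q j := by
  simp only [contribution, aggregate]
  push_cast
  rw [Finset.sum_comm]
  exact Finset.sum_congr rfl fun j _ => by rw [Finset.sum_mul]

theorem aggregate_eq_zero_or {m n M : ℕ} (X : Fin m → Fin n → Fin (M + 1)) (j : Fin n) :
    aggregate X j = 0 ∨ 1 ≤ aggregate X j := by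
  have h : aggregate X j = ((∑ i, (X i j : ℕ) : ℕ) : ℝ) := by simp [aggregate]
  rw [h]
  rcases Nat.eq_zero_or_pos (∑ i, (X i j : ℕ)) with h | h
  · left
    rw [h, Nat.cast_zero]
  · right
    exact_mod_cast h

theorem sum_aggregate_le {m n M : ℕ} (X : Fin m → Fin n → Fin (M + 1)) :
    ∑ j, aggregate X j ≤ (n : ℝ) * m * M := by
  have h : ∀ j, aggregate X j ≤ m * M := by
    intro j
    rw [aggregate]
    refine (Finset.sum_le_card_nsmul _ _ (M : ℝ) fun i _ => ?_).trans (by simp)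
    exact_mod_cast Nat.lt_succ_iff.1 (X i j).2
  refine (Finset.sum_le_card_nsmul _ _ _ fun j _ => h j).trans (le_of_eq ?_)
  simp [mul_assoc]

theorem sum_aggregate_pos {m n M : ℕ} {X : Fin m → Fin n → Fin (M + 1)} (hX : aggregate X ≠ 0) :
    0 < ∑ j, aggregate X j := by
  have h0 : ∀ j, 0 ≤ aggregate X j := fun j => by
    rcases aggregate_eq_zero_or X j with h | h <;> linarith
  refine (Finset.sum_nonneg fun j _ => h0 j).lt_of_ne fun h => hX ?_
  funext j
  exact (Finset.sum_eq_zero_iff_of_nonneg fun j _ => h0 j).1 h.symm j (Finset.mem_univ j)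

/-- The protocol for entropy estimation, for any admissible choice of the parameters. -/
theorem exists_entropyProtocol {n m M : ℕ} {G : SimpleGraph (Fin m)} (hG : G.Connected)
    {N τ L η γ T R : ℝ} {k b : ℕ} (hN : N = (n : ℝ) * m * M) (hN1 : 1 ≤ N) (hτ : 0 < τ)
    (hτ1 : τ ≤ 1 / 40)
    (hL : Real.log N + Real.log (2 / τ) + 1 + Real.log (1 / τ) ≤ L) (hL1 : 1 ≤ L) (hη : 0 < η)
    (hηL : 3 * η * L ≤ τ) (hk : 100 / τ ^ 2 ≤ k) (hγ : 0 < γ)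
    (hγη : (k + 1) * (γ / η ^ 2) ≤ 1 / 40) (hNT : N ≤ T)
    (hT : 40 * (k * (N * (Real.log (2 * N / τ ^ 2) / τ))) ≤ T) (hR : 0 < R)
    (hRT : (k + 1) * (m * T / R) ≤ 1 / 40) (hb : R ≤ (1 + γ) ^ (2 ^ b - 1)) :
    ∃ P : Protocol G (Fin n → Fin (M + 1)), EstimatesEntropy P (8 * τ) ∧
      P.maxCommunication ≤ 2 * ((k + 1) * b) := by
  classical
  have hT0 : 0 < T := by linarith
  have hN0 : 0 < N := by linarith
  have hkpos : (0 : ℝ) < k := lt_of_lt_of_le (by positivity) hk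
  have hk0 : 0 < k := Nat.cast_pos.1 hkpos
  have hg : (1 : ℝ) < 1 + γ := by linarith
  obtain ⟨root⟩ := hG.nonempty
  obtain ⟨par, d, hroot, hpar⟩ := exists_parent hG root
  let S : RootedTree (Fin m) := ⟨root, par, d, hroot, fun u hu => (hpar u hu).2⟩
  obtain ⟨Ω, _, μ, _, Z, hZm, hZ0, hZi, hZE, hφ⟩ := exists_entropySketch hN1 hτ (by linarith)
  let ι := {X : Fin m → Fin n → Fin (M + 1) // aggregate X ≠ 0}
  let p : ι → Fin n → ℝ := fun X j => aggregate X.1 j / ∑ i, aggregate X.1 i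
  have hWpos : ∀ X : ι, 0 < ∑ i, aggregate X.1 i := fun X => sum_aggregate_pos X.2
  have hWN : ∀ X : ι, ∑ i, aggregate X.1 i ≤ N := fun X => hN ▸ sum_aggregate_le X.1
  have hp : ∀ X : ι, (∀ j, p X j = 0 ∨ 1 / N ≤ p X j ∧ p X j ≤ 1) ∧ ∑ j, p X j = 1 := fun X =>
    weights_of_nat (aggregate_eq_zero_or X.1) (hWpos X) (hWN X)
  let badZ : ι → Set (Fin k → Fin n → Ω) := fun X =>
    {ω | τ * sketchMean μ Z (p X) ≤
      |(∑ q, Real.exp (-∑ j, p X j * Z (ω q j))) / k - sketchMean μ Z (p X)|} ∪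
    {ω | ∃ q, T ≤ ∑ j, aggregate X.1 j * ⌊Z (ω q j) / τ⌋₊}
  have hbadZ : ∀ X, (Measure.pi fun _ : Fin k => Measure.pi fun _ : Fin n => μ).real (badZ X) <
      1 / 10 := by
    intro X
    refine lt_of_le_of_lt (measureReal_union_le _ _) ?_
    have h1 := measureReal_average_le hZm hZ0 hφ hN0 hτ hτ1 (hp X).1 (hp X).2 hk
    have h2 := measureReal_exists_floor_gt_le (k := k) hZm hZ0 hZi hτ
      (x := fun j => aggregate X.1 j)
      (fun j => by rcases aggregate_eq_zero_or X.1 j with h | h <;> linarith) (hWN X) hT0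
      (by rw [integral_div, hZE]; exact hT)
    linarith
  obtain ⟨L₁, s₁, hs₁⟩ := exists_finite_sample _ badZ (1 / 10) hbadZ
  let z : Fin (2 ^ L₁) → Fin k → Fin n → ℝ := fun i q j => Z (s₁ i q j)
  let a : Fin (2 ^ L₁) → ι → Option (Fin k) → Fin m → ℝ := fun i X q u =>
    contribution τ (z i) q (X.1 u)
  have hasum : ∀ i X q, ∑ u, a i X q u = ∑ j, aggregate X.1 j * multiplier τ (z i) q j :=
    fun i X q => sum_contribution τ (z i) q X.1
  -- The thresholds are sampled after the sketches. Only pairs whose sketch is good for the input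
  -- matter: there the register totals are at most `T`, so overflow is unlikely.
  let ι₂ := {y : Fin (2 ^ L₁) × ι // s₁ y.1 ∉ badZ y.2}
  let badΘ : Fin (2 ^ L₁) × ι → Set (Option (Fin k) → Fin m → ℝ) := fun y =>
    {θ | ∃ q, η * (∑ u, a y.1 y.2 q u) <
        |S.val (1 + γ) (a y.1 y.2 q) S.root (θ q) - ∑ u, a y.1 y.2 q u| ∨
      ∃ u, R ≤ S.val (1 + γ) (a y.1 y.2 q) u (θ q)}
  have hbadΘ : ∀ y : ι₂, (Measure.pi fun _ : Option (Fin k) =>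
      RootedTree.thresholdLaw (Fin m)).real (badΘ y.1) < 1 / 10 := by
    rintro ⟨⟨i, X⟩, hy⟩
    refine lt_of_le_of_lt (measureReal_exists_bad_rounding_le S hg hη hR (T := T)
      (fun q u => contribution_eq_zero_or τ (z i) q (X.1 u)) fun q => ?_) ?_
    · change ∑ u, a i X q u ≤ T
      rw [hasum]
      cases q with
      | none => simpa [multiplier] using (hWN X).trans hNT
      | some q =>
        by_contra h
        exact hy (Or.inr ⟨q, (not_le.1 h).le⟩)
    · rw [Fintype.card_option, Fintype.card_fin, Fintype.card_fin, add_sub_cancel_left, mul_add]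
      push_cast
      linarith
  obtain ⟨L₂, s₂, hs₂⟩ := exists_finite_sample _ (fun y : ι₂ => badΘ y.1) (1 / 10) hbadΘ
  have e : (Fin (L₁ + L₂) → Bool) ≃ Fin (2 ^ L₁) × Fin (2 ^ L₂) :=
    Fintype.equivOfCardEq (by simp [pow_add])
  obtain ⟨enc, dec, hdec, hlen⟩ := exists_encoding (Option (Fin k)) b
  -- Reduction modulo `2 ^ b` forces codes into the fixed message length. On the good event every
  -- code is below `2 ^ b`, so it changes nothing.
  let step : (Fin (L₁ + L₂) → Bool) → Fin m → (Fin n → Fin (M + 1)) →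
      (Fin m → Option (Fin k) → Fin (2 ^ b)) → Option (Fin k) → Fin (2 ^ b) := fun σ u x f q =>
    ⟨roundCode (1 + γ) (contribution τ (z (e σ).1) q x +
      ∑ w ∈ S.children u, gridVal (1 + γ) (f w q)) (s₂ (e σ).2 q u) % 2 ^ b,
      Nat.mod_lt _ (by positivity)⟩
  obtain ⟨P, hP, hPout⟩ := exists_treeProtocol (G := G) hroot hpar enc dec hdec hlen step
    (fun σ u x f f' h => by
      funext q
      have : ∑ w ∈ S.children u, gridVal (1 + γ) (f w q) =
          ∑ w ∈ S.children u, gridVal (1 + γ) (f' w q) :=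
        Finset.sum_congr rfl fun w hw => by
          have hw' := (Finset.mem_filter.1 hw).2
          rw [h w hw'.1 hw'.2]
      simp only [step, this])
    (fun _ c => entropyEstimate k τ fun q => gridVal (1 + γ) (c q))
  refine ⟨P, fun X hX => ?_, by simpa using hP⟩
  let X' : ι := ⟨X, hX⟩
  have key : ∀ i l, s₁ i ∉ badZ X' → s₂ l ∉ badΘ (i, X') → ∀ ω, e (firstCoins (L₁ + L₂) ω) = (i, l) →
      |P.output X ω - shannonEntropy (aggregate X)| ≤ 8 * τ := by
    intro i l hi hl ω hω
    have hval : ∀ q u, S.val (1 + γ) (a i X' q) u (s₂ l q) < R := by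
      intro q u
      by_contra h
      exact hl ⟨q, Or.inr ⟨u, not_lt.1 h⟩⟩
    have hcode : ∀ q u, S.code (1 + γ) (a i X' q) (s₂ l q) u < 2 ^ b := fun q u =>
      code_lt_of_val_lt hg hb (hval q u)
    rw [hPout X ω (fun u q => ⟨S.code (1 + γ) (a i X' q) (s₂ l q) u, hcode q u⟩) (fun u => by
      funext q
      refine Fin.ext ?_
      simp only [step, hω]
      change _ = roundCode (1 + γ) (S.tot (1 + γ) (a i X' q) u (s₂ l q)) (s₂ l q u) % 2 ^ b
      rw [← S.code_eq, Nat.mod_eq_of_lt (hcode q u)])]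
    obtain ⟨hm0, hm1⟩ := sketchMean_bounds hφ (hp X').1 (hp X').2
    have hclose : ∀ q, |S.val (1 + γ) (a i X' q) S.root (s₂ l q) -
        ∑ j, aggregate X j * multiplier τ (z i) q j| ≤
          η * ∑ j, aggregate X j * multiplier τ (z i) q j := by
      intro q
      by_contra h
      refine hl ⟨q, Or.inl ?_⟩
      change η * (∑ u, a i X' q u) < |_ - ∑ u, a i X' q u|
      rw [hasum]
      exact not_le.1 h
    refine abs_entropyEstimate_sub_le hN0 hτ hτ1 hη hL hL1 hηL (aggregate_eq_zero_or X) (hWpos X')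
      (hWN X') hk0 hm0 hm1 (z := z i) (fun q j => hZ0 _) ?_ (fun q => hclose (some q)) ?_
    · by_contra h
      exact hi (Or.inl (not_le.1 h).le)
    · have h := hclose none
      simp only [multiplier, Nat.cast_one, mul_one] at h
      exact h
  let good : Finset (Fin (2 ^ L₁) × Fin (2 ^ L₂)) :=
    Finset.univ.filter fun y => s₁ y.1 ∉ badZ X' ∧ s₂ y.2 ∉ badΘ (y.1, X')
  have hcard := card_good_ge {i | s₁ i ∈ badZ X'} (fun i => {l | s₂ l ∈ badΘ (i, X')})
    (by simpa using hs₁ X')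
    (fun i hi => by simpa using hs₂ ⟨(i, X'), hi⟩) good
    (fun i l hi hl => Finset.mem_filter.2 ⟨Finset.mem_univ _, hi, hl⟩)
  have hprob := coinLaw_firstCoins_mem (L₁ + L₂) (good.map e.symm.toEmbedding)
  have hfin : IsProbabilityMeasure coinLaw := by unfold coinLaw; infer_instance
  calc (3 / 4 : ℝ) ≤ good.card / 2 ^ (L₁ + L₂) := by
        rw [le_div_iff₀ (by positivity), pow_add]
        simpa using hcard
    _ = coinLaw.real {ω | firstCoins (L₁ + L₂) ω ∈ good.map e.symm.toEmbedding} := by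
        rw [hprob, Finset.card_map]
    _ ≤ _ := by
        refine measureReal_mono (fun ω hω => ?_) (measure_ne_top _ _)
        obtain ⟨⟨i, l⟩, hy, hyω⟩ := Finset.mem_map.1 hω
        have hy' := (Finset.mem_filter.1 hy).2
        exact key i l hy'.1 hy'.2 ω (by rw [← hyω]; simp)

/-! ### Choice of the parameters and the bound in bits -/

theorem one_le_log_of_three_le {N : ℝ} (hN : 3 ≤ N) : 1 ≤ Real.log N := by
  rw [Real.le_log_iff_exp_le (by linarith)]
  have := Real.exp_one_lt_d9
  linarith

theorem log_log_three_pos : 0 < Real.log (Real.log 3) := by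
  refine Real.log_pos ?_
  rw [Real.lt_log_iff_exp_lt (by norm_num)]
  have := Real.exp_one_lt_d9
  linarith

theorem log_log_three_le {N : ℝ} (hN : 3 ≤ N) :
    Real.log (Real.log 3) ≤ Real.log (Real.log N) :=
  Real.log_le_log (by linarith [one_le_log_of_three_le (le_refl (3:ℝ))])
    (Real.log_le_log (by norm_num) hN)

theorem le_one_add_pow {γ R : ℝ} {E : ℕ} (hγ : 0 < γ) (hγ1 : γ ≤ 1) (hR : 0 < R)
    (h : 2 * Real.log R / γ ≤ E) : R ≤ (1 + γ) ^ E := by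
  rw [← Real.log_le_log_iff hR (by positivity), Real.log_pow]
  have h1 : γ / 2 ≤ Real.log (1 + γ) := by
    have h2 := Real.one_sub_inv_le_log_of_pos (show 0 < 1 + γ by linarith)
    have h3 : (1 + γ)⁻¹ ≤ 1 - γ / 2 := by
      rw [inv_le_iff_one_le_mul₀ (by linarith)]
      nlinarith
    linarith
  rw [div_le_iff₀ hγ] at h
  have h4 : (E : ℝ) * (γ / 2) ≤ E * Real.log (1 + γ) :=
    mul_le_mul_of_nonneg_left h1 (Nat.cast_nonneg E)
  linarith

/-- Entropy estimation with explicit bounds on the number of registers and their size. -/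
theorem exists_entropyProtocol_bits {n m M : ℕ} {G : SimpleGraph (Fin m)} (hG : G.Connected)
    {N x : ℝ} (hN : N = (n : ℝ) * m * M) (hN3 : 3 ≤ N) (hmN : (m : ℝ) ≤ N) (hx : 40 ≤ x) :
    ∃ (P : Protocol G (Fin n → Fin (M + 1))) (k b : ℕ), EstimatesEntropy P (8 / x) ∧
      P.maxCommunication ≤ 2 * ((k + 1) * b) ∧ (k : ℝ) + 1 ≤ 102 * x ^ 2 ∧
      (b : ℝ) ≤ 35 + 14 * Real.log x + 6 * Real.log (Real.log N) := by
  have hx0 : 0 < x := by linarith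
  have hN0 : 0 < N := by linarith
  set l := Real.log N with hl
  have hl1 : 1 ≤ l := one_le_log_of_three_le hN3
  have hl0 : 0 < l := by linarith
  have hx2 : 1600 ≤ x ^ 2 := by nlinarith
  have hxl : x ≤ x * l := by nlinarith
  have hlxl : 40 * l ≤ x * l := by nlinarith
  have hlogx : Real.log x ≤ x := (Real.log_le_sub_one_of_pos hx0).trans (by linarith)
  have hlogx0 : 0 ≤ Real.log x := Real.log_nonneg (by linarith)
  have hk1 : (⌈100 * x ^ 2⌉₊ : ℝ) + 1 ≤ 102 * x ^ 2 := by
    have := Nat.ceil_lt_add_one (show 0 ≤ 100 * x ^ 2 by positivity)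
    linarith
  set k := ⌈100 * x ^ 2⌉₊ with hk
  have hkx : 100 * x ^ 2 ≤ (k : ℝ) := Nat.le_ceil _
  -- `Y - 1` dominates `2 * log R / γ`, a number of powers of `1 + γ` sufficient to reach `R`; the
  -- `+ 1` pays for the exponent `2 ^ b - 1`.
  set Y := 10 ^ 7 * x ^ 7 * l ^ 3 + 1 with hY
  have hY1 : 1 ≤ Y := by
    have : 0 ≤ 10 ^ 7 * x ^ 7 * l ^ 3 := by positivity
    linarith
  set b := ⌈Real.log Y / Real.log 2⌉₊ with hb
  have hlog2 : 1 / 2 ≤ Real.log 2 := by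
    have := Real.log_two_gt_d9
    linarith
  have hYb : Y ≤ 2 ^ b := by
    rw [← Real.log_le_log_iff (by linarith) (by positivity), Real.log_pow,
      ← div_le_iff₀ (by linarith)]
    exact Nat.le_ceil _
  have hbY : (b : ℝ) ≤ 35 + 14 * Real.log x + 6 * Real.log l := by
    have h0 : 0 ≤ Real.log Y := Real.log_nonneg hY1
    have h1 := Nat.ceil_lt_add_one (show 0 ≤ Real.log Y / Real.log 2 by positivity)
    have h2 : Real.log Y / Real.log 2 ≤ 2 * Real.log Y := by
      rw [div_le_iff₀ (by linarith)]
      nlinarith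
    have h3 : Real.log Y ≤ 17 + 7 * Real.log x + 3 * Real.log l := by
      have h4 : Y ≤ 2 * 10 ^ 7 * (x ^ 7 * l ^ 3) := by
        have : 1 ≤ x ^ 7 * l ^ 3 := one_le_mul_of_one_le_of_one_le
          (one_le_pow₀ (by linarith)) (one_le_pow₀ hl1)
        rw [hY]
        linarith
      have h5 := Real.log_le_log (by linarith) h4
      rw [Real.log_mul (show (2 * 10 ^ 7 : ℝ) ≠ 0 by norm_num) (by positivity),
        Real.log_mul (show x ^ 7 ≠ 0 by positivity) (by positivity), Real.log_pow, Real.log_pow] at h5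
      have h6 : Real.log (2 * 10 ^ 7) ≤ 17 := by
        rw [Real.log_le_iff_le_exp (by norm_num)]
        have h7 : (2.7182818283 : ℝ) ^ 17 ≤ Real.exp 1 ^ 17 :=
          pow_le_pow_left₀ (by norm_num) Real.exp_one_gt_d9.le 17
        rw [← Real.exp_nat_mul] at h7
        norm_num at h7 ⊢
        linarith
      push_cast at h5
      linarith
    linarith
  have hLle : Real.log N + Real.log (2 / (1 / x)) + 1 + Real.log (1 / (1 / x)) ≤ 4 * x * l := by
    rw [one_div_one_div, div_div_eq_mul_div, div_one]
    have h1 : Real.log (2 * x) ≤ 2 * x := (Real.log_le_sub_one_of_pos (by positivity)).trans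
      (by linarith)
    linarith
  have hlogY : Real.log (2 * N / (1 / x) ^ 2) ≤ 2 * N * x ^ 2 := by
    have h1 : 2 * N / (1 / x) ^ 2 = 2 * N * x ^ 2 := by field_simp
    rw [h1]
    exact (Real.log_le_sub_one_of_pos (by positivity)).trans (by linarith)
  have hlogR : Real.log (4 * 10 ^ 7 * x ^ 7 * N ^ 3) ≤ 8 * x * l := by
    rw [Real.log_mul (by positivity) (by positivity), Real.log_mul (by positivity) (by positivity),
      Real.log_pow, Real.log_pow]
    have h6 : Real.log (4 * 10 ^ 7) ≤ 18 := by
      rw [Real.log_le_iff_le_exp (by norm_num)]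
      have h7 : (2.7182818283 : ℝ) ^ 18 ≤ Real.exp 1 ^ 18 :=
        pow_le_pow_left₀ (by norm_num) Real.exp_one_gt_d9.le 18
      rw [← Real.exp_nat_mul] at h7
      norm_num at h7 ⊢
      linarith
    push_cast
    linarith
  -- `η` gives `3 * η * L = τ` exactly, and `γ` is of order `η ^ 2 / k`, so that Chebyshev's
  -- inequality survives a union bound over `k + 1` registers. `T` and `R` come from Markov's
  -- inequality, for the sketches and for all partial sums; only their logarithms affect the cost,
  -- so crude powers of `N` suffice.
  obtain ⟨P, hP1, hP2⟩ := exists_entropyProtocol hG (N := N) (τ := 1 / x) (L := 4 * x * l)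
    (η := 1 / (12 * x ^ 2 * l)) (γ := 1 / (6 * 10 ^ 5 * x ^ 6 * l ^ 2)) (T := 8080 * x ^ 5 * N ^ 2)
    (R := 4 * 10 ^ 7 * x ^ 7 * N ^ 3) (k := k) (b := b) hN (by linarith) (by positivity)
    (one_div_le_one_div_of_le (by norm_num) hx) hLle (by nlinarith) (by positivity) (by
      refine le_of_eq ?_
      field_simp
      norm_num) (by
      rw [one_div, inv_pow, div_inv_eq_mul]
      exact hkx) (by positivity) (by
      have h1 : 1 / (6 * 10 ^ 5 * x ^ 6 * l ^ 2) / (1 / (12 * x ^ 2 * l)) ^ 2 =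
          144 / (6 * 10 ^ 5 * x ^ 2) := by
        field_simp
        norm_num
      rw [h1, ← mul_div_assoc, div_le_iff₀ (by positivity)]
      linarith) (by
      have h1 : 1 ≤ x ^ 5 := one_le_pow₀ (by linarith)
      have h2 : N ≤ N ^ 2 := by nlinarith
      have h3 : N ^ 2 ≤ x ^ 5 * N ^ 2 := le_mul_of_one_le_left (by positivity) h1
      nlinarith) (by
      have h1 : Real.log (2 * N / (1 / x) ^ 2) / (1 / x) ≤ 2 * N * x ^ 3 := by
        rw [div_le_iff₀ (by positivity)]
        refine hlogY.trans (le_of_eq ?_)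
        field_simp
      have h2 : (k : ℝ) ≤ 101 * x ^ 2 := by
        have := Nat.ceil_lt_add_one (show 0 ≤ 100 * x ^ 2 by positivity)
        linarith
      calc 40 * (k * (N * (Real.log (2 * N / (1 / x) ^ 2) / (1 / x))))
          ≤ 40 * ((101 * x ^ 2) * (N * (2 * N * x ^ 3))) := by
            refine mul_le_mul_of_nonneg_left ?_ (by norm_num)
            refine mul_le_mul h2 (mul_le_mul_of_nonneg_left h1 hN0.le) ?_ (by positivity)
            have h3 : 0 ≤ Real.log (2 * N / (1 / x) ^ 2) := by
              refine Real.log_nonneg ?_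
              rw [one_div, inv_pow, div_inv_eq_mul]
              nlinarith
            positivity
        _ = _ := by ring) (by positivity) (by
      rw [mul_div_assoc']
      rw [div_le_iff₀ (by positivity)]
      calc ((k : ℝ) + 1) * (m * (8080 * x ^ 5 * N ^ 2))
          ≤ (102 * x ^ 2) * (N * (8080 * x ^ 5 * N ^ 2)) := by gcongr
        _ = 824160 * (x ^ 7 * N ^ 3) := by ring
        _ ≤ 10 ^ 6 * (x ^ 7 * N ^ 3) := by gcongr; norm_num
        _ = _ := by ring) (by
      refine le_one_add_pow (by positivity) ?_ (by positivity) ?_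
      · rw [div_le_one (by positivity)]
        have h1 : 1 ≤ x ^ 6 * l ^ 2 := one_le_mul_of_one_le_of_one_le
          (one_le_pow₀ (by linarith)) (one_le_pow₀ hl1)
        nlinarith
      · have h1 : ((2 ^ b - 1 : ℕ) : ℝ) = 2 ^ b - 1 := by
          rw [Nat.cast_sub Nat.one_le_two_pow]
          simp
        rw [h1, div_div_eq_mul_div, div_one]
        have h2 : 2 * Real.log (4 * 10 ^ 7 * x ^ 7 * N ^ 3) * (6 * 10 ^ 5 * x ^ 6 * l ^ 2) ≤
            2 * (8 * x * l) * (6 * 10 ^ 5 * x ^ 6 * l ^ 2) := by gcongr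
        have h3 : 2 * (8 * x * l) * (6 * 10 ^ 5 * x ^ 6 * l ^ 2) ≤ 10 ^ 7 * x ^ 7 * l ^ 3 := by
          have : 2 * (8 * x * l) * (6 * 10 ^ 5 * x ^ 6 * l ^ 2) =
            96 * 10 ^ 5 * (x ^ 7 * l ^ 3) := by ring
          rw [this, mul_assoc (10 ^ 7 : ℝ)]
          gcongr
          norm_num
        linarith)
  refine ⟨P, k, b, ?_, hP2, hk1, hbY⟩
  rwa [mul_one_div] at hP1

theorem EstimatesEntropy.mono {m n M : ℕ} {G : SimpleGraph (Fin m)}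
    {P : Protocol G (Fin n → Fin (M + 1))} {ε ε' : ℝ} (h : EstimatesEntropy P ε) (hε : ε ≤ ε') :
    EstimatesEntropy P ε' := by
  intro X hX
  have : IsProbabilityMeasure coinLaw := by unfold coinLaw; infer_instance
  refine (h X hX).trans (measureReal_mono (fun ω hω => ?_) (measure_ne_top _ _))
  rw [Set.mem_ofPred_eq] at hω ⊢
  exact hω.trans hε

theorem exists_entropyProtocol_log_log :
    ∃ C : ℝ, 0 ≤ C ∧ ∀ (n m M : ℕ) (ε : ℝ) (G : SimpleGraph (Fin m)),
      3 ≤ n * m * M → 0 < ε → ε < 1 → G.Connected →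
        ∃ P : Protocol G (Fin n → Fin (M + 1)), EstimatesEntropy P ε ∧
          (P.maxCommunication : ℝ) ≤
            C * ((1 / ε ^ 2) * (Real.log (Real.log ((n : ℝ) * m * M)) + Real.log (1 / ε))) := by
  set c₀ := Real.log (Real.log 3) with hc₀
  have hc0 : 0 < c₀ := log_log_three_pos
  -- With `x = 40 / ε`, `1600` is `40 ^ 2` and `91 = 35 + 14 * 4` collects the additive constants in
  -- `b`; they are absorbed using `log log N ≥ c₀ > 0`.
  refine ⟨2 * 102 * 1600 * (91 / c₀ + 20), by positivity, fun n m M ε G h3 hε hε1 hG => ?_⟩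
  set N : ℝ := (n : ℝ) * m * M with hN
  have hN3 : 3 ≤ N := by rw [hN]; exact_mod_cast h3
  have hmN : (m : ℝ) ≤ N := by
    have h1 : 0 < n * m * M := by omega
    have hn : 0 < n := Nat.pos_of_ne_zero (by rintro rfl; simp at h1)
    have hM : 0 < M := Nat.pos_of_ne_zero (by rintro rfl; simp at h1)
    rw [hN]
    exact_mod_cast (Nat.le_mul_of_pos_left m hn).trans (Nat.le_mul_of_pos_right _ hM)
  have hx : 40 ≤ 40 / ε := by
    rw [le_div_iff₀ hε]
    linarith
  obtain ⟨P, k, b, h1, h2, h4, h5⟩ := exists_entropyProtocol_bits hG hN hN3 hmN hx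
  refine ⟨P, h1.mono ?_, ?_⟩
  · rw [div_div_eq_mul_div]
    linarith
  have hll : c₀ ≤ Real.log (Real.log N) := log_log_three_le hN3
  have hle : 0 ≤ Real.log (1 / ε) := Real.log_nonneg (by rw [le_div_iff₀ hε]; linarith)
  have hlogx : Real.log (40 / ε) ≤ 4 + Real.log (1 / ε) := by
    rw [div_eq_mul_one_div, Real.log_mul (by norm_num) (by positivity)]
    have h6 : Real.log 40 ≤ 4 := by
      rw [Real.log_le_iff_le_exp (by norm_num)]
      have h7 : (2.7182818283 : ℝ) ^ 4 ≤ Real.exp 1 ^ 4 :=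
        pow_le_pow_left₀ (by norm_num) Real.exp_one_gt_d9.le 4
      rw [← Real.exp_nat_mul] at h7
      norm_num at h7 ⊢
      linarith
    linarith
  have h91 : 91 ≤ 91 / c₀ * Real.log (Real.log N) := by
    rw [div_mul_eq_mul_div, le_div_iff₀ hc0]
    linarith
  have hb : (b : ℝ) ≤ (91 / c₀ + 20) * (Real.log (Real.log N) + Real.log (1 / ε)) := by
    have : 0 ≤ 91 / c₀ * Real.log (1 / ε) := by positivity
    linarith
  have hP : (P.maxCommunication : ℝ) ≤ 2 * (((k : ℝ) + 1) * b) := by exact_mod_cast h2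
  refine hP.trans ?_
  calc 2 * (((k : ℝ) + 1) * b)
      ≤ 2 * ((102 * (40 / ε) ^ 2) *
        ((91 / c₀ + 20) * (Real.log (Real.log N) + Real.log (1 / ε)))) := by gcongr
    _ = _ := by
      field_simp
      ring

/-! ### Polynomially many players and polynomially large entries -/

/-- A protocol without communication. -/
theorem exists_maxCommunication_eq_zero {V I : Type} [Fintype V] (G : SimpleGraph V) (v : V) :
    ∃ P : Protocol G I, P.maxCommunication = 0 :=
  ⟨{  rounds := 0
      len := fun _ _ _ => 0
      len_eq_zero := fun _ _ _ _ => rfl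
      msg := fun _ _ _ _ _ _ => []
      length_msg := fun _ _ _ _ _ _ => rfl
      measurableSet_msg := fun _ _ _ _ _ _ => MeasurableSet.const _
      center := v
      out := fun _ _ _ => 0
      measurable_out := fun _ _ => measurable_const },
    by simp [Protocol.maxCommunication, Protocol.edgeBits]⟩

/-- Here `log (nmM) ≤ B * log n`, so the iterated logarithm grows only by `log B`, absorbed by means
of `log log n ≥ log log 3`. -/
theorem exists_log_log_le (K c : ℝ) : ∃ D : ℝ, 1 ≤ D ∧ ∀ n m M : ℕ, 3 ≤ n → 1 ≤ m → 1 ≤ M →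
    (m : ℝ) ≤ K * (n : ℝ) ^ c → (M : ℝ) ≤ K * (n : ℝ) ^ c →
      Real.log (Real.log ((n : ℝ) * m * M)) ≤ D * Real.log (Real.log n) := by
  set c₀ := Real.log (Real.log 3) with hc₀
  have hc0 : 0 < c₀ := log_log_three_pos
  set B := 1 + 2 * |Real.log K| + 2 * |c| with hB
  have hB1 : 1 ≤ B := by
    have h1 := abs_nonneg (Real.log K)
    have h2 := abs_nonneg c
    linarith
  have hlB : 0 ≤ Real.log B := Real.log_nonneg hB1
  refine ⟨1 + Real.log B / c₀, by linarith [div_nonneg hlB hc0.le],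
    fun n m M hn hm hM hmK hMK => ?_⟩
  have hn3 : (3 : ℝ) ≤ n := by exact_mod_cast hn
  have hm1 : (1 : ℝ) ≤ m := by exact_mod_cast hm
  have hM1 : (1 : ℝ) ≤ M := by exact_mod_cast hM
  have hn0 : (0 : ℝ) < n := by linarith
  have hln : 1 ≤ Real.log n := one_le_log_of_three_le hn3
  have hnc : 0 < (n : ℝ) ^ c := Real.rpow_pos_of_pos hn0 c
  have hK : 0 < K := by
    by_contra h
    have := mul_nonpos_of_nonpos_of_nonneg (not_lt.1 h) hnc.le
    linarith
  have hlog : ∀ y : ℝ, 1 ≤ y → y ≤ K * (n : ℝ) ^ c →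
      Real.log y ≤ |Real.log K| + |c| * Real.log n := by
    intro y hy hyK
    have h1 := Real.log_le_log (by linarith) hyK
    rw [Real.log_mul hK.ne' hnc.ne', Real.log_rpow hn0] at h1
    have h2 := le_abs_self (Real.log K)
    have h3 := mul_le_mul_of_nonneg_right (le_abs_self c) (by linarith : 0 ≤ Real.log (n : ℝ))
    linarith
  have h1 : Real.log ((n : ℝ) * m * M) ≤ B * Real.log n := by
    rw [Real.log_mul (by positivity) (by positivity), Real.log_mul (by positivity) (by positivity)]
    have h2 := hlog m hm1 hmK
    have h3 := hlog M hM1 hMK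
    have h4 : |Real.log K| ≤ |Real.log K| * Real.log n :=
      le_mul_of_one_le_right (abs_nonneg _) hln
    rw [hB]
    linarith
  have h2 : 0 < Real.log ((n : ℝ) * m * M) := by
    refine Real.log_pos ?_
    have : (1 : ℝ) ≤ m * M := one_le_mul_of_one_le_of_one_le hm1 hM1
    rw [mul_assoc]
    nlinarith
  have h3 := Real.log_le_log h2 h1
  rw [Real.log_mul (show B ≠ 0 by positivity) (by positivity)] at h3
  have h4 : Real.log B ≤ Real.log B / c₀ * Real.log (Real.log n) := by
    rw [div_mul_eq_mul_div, le_div_iff₀ hc0]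
    exact mul_le_mul_of_nonneg_left (log_log_three_le hn3) hlB
  linarith

end MessagePassing

end

theorem theorem5p3 :
    -- inputs and networks of arbitrary size
    (∃ C : ℝ, ∀ (n m M : ℕ) (ε : ℝ) (G : SimpleGraph (Fin m)),
      3 ≤ n * m * M → 0 < ε → ε < 1 → G.Connected →
        ∃ P : MessagePassing.Protocol G (Fin n → Fin (M + 1)),
          MessagePassing.EstimatesEntropy P ε ∧
          (P.maxCommunication : ℝ) ≤
            C * ((1 / ε ^ 2) * (Real.log (Real.log ((n : ℝ) * m * M)) + Real.log (1 / ε)))) ∧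
    -- number of players and size of the entries polynomial in the dimension
    (∀ K c : ℝ, ∃ C : ℝ, ∀ (n m M : ℕ) (ε : ℝ) (G : SimpleGraph (Fin m)),
      3 ≤ n → (m : ℝ) ≤ K * (n : ℝ) ^ c → (M : ℝ) ≤ K * (n : ℝ) ^ c →
      0 < ε → ε < 1 → G.Connected →
        ∃ P : MessagePassing.Protocol G (Fin n → Fin (M + 1)),
          MessagePassing.EstimatesEntropy P ε ∧
          (P.maxCommunication : ℝ) ≤
            C * ((1 / ε ^ 2) * (Real.log (Real.log n) + Real.log (1 / ε)))) := by

  obtain ⟨C, hC0, hC⟩ := MessagePassing.exists_entropyProtocol_log_log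
  refine ⟨⟨C, hC⟩, fun K c => ?_⟩
  obtain ⟨D, hD1, hD⟩ := MessagePassing.exists_log_log_le K c
  refine ⟨C * D, fun n m M ε G hn hm hM hε hε1 hG => ?_⟩
  obtain ⟨v⟩ := hG.nonempty
  have hn3 : (3 : ℝ) ≤ n := by exact_mod_cast hn
  have hll : 0 < Real.log (Real.log n) :=
    MessagePassing.log_log_three_pos.trans_le (MessagePassing.log_log_three_le hn3)
  have hle : 0 ≤ Real.log (1 / ε) := Real.log_nonneg (by rw [le_div_iff₀ hε]; linarith)
  have hm1 : 1 ≤ m := Nat.one_le_iff_ne_zero.2 (by rintro rfl; exact v.elim0)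
  rcases Nat.eq_zero_or_pos M with rfl | hM1
  -- For `M = 0` the condition `3 ≤ n * m * M` fails, but every aggregate vanishes and correctness
  -- is vacuous.
  · obtain ⟨P, hP⟩ := MessagePassing.exists_maxCommunication_eq_zero
      (I := Fin n → Fin (0 + 1)) G v
    refine ⟨P, fun X hX => absurd ?_ hX, ?_⟩
    · funext j
      exact Finset.sum_eq_zero fun i _ => by simp
    · rw [hP, Nat.cast_zero]
      positivity
  · obtain ⟨P, hP1, hP2⟩ := hC n m M ε G
      (hn.trans (by
        rw [mul_assoc]
        exact Nat.le_mul_of_pos_right n (Nat.mul_pos hm1 hM1))) hε hε1 hG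
    refine ⟨P, hP1, hP2.trans ?_⟩
    rw [mul_assoc C D]
    refine mul_le_mul_of_nonneg_left ?_ hC0
    rw [mul_left_comm D]
    refine mul_le_mul_of_nonneg_left ?_ (by positivity)
    have h1 := hD n m M hn hm1 hM1 hm hM
    have h2 : Real.log (1 / ε) ≤ D * Real.log (1 / ε) := le_mul_of_one_le_left hle hD1
    linarith
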